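/- Let $N^{(q,n)}$ be a non-empty supermanifold with $q$ even and $n$ odd dimensions, $(q,n)\neq(0,0)$, with an even Riemannian metric $g_2$ (supersymmetric, nondegenerate, of any signature). Let $\mathbb{R}^{(1,2)}$ have the coordinates $(t,\xi,\eta)$, $t$ even and $\xi,\eta$ odd, and the metric $g_1$ with $g_1(\partial_t,\partial_t)=-1$, $g_1(\partial_\xi,\partial_\eta)=-1$, $g_1(\partial_\eta,\partial_\xi)=1$ and $g_1=0$ on all other pairs of coordinate fields. Let $h=h(t)$ be a smooth nowhere vanishing function on $\mathbb{R}$, $\mu=h^2$, and let $M_2=\mathbb{R}^{(1,2)}\times_\mu N^{(q,n)}$ be the warped product, that is, the product supermanifold with the metric $g_\mu=g_1+h(t)^2g_2$. Let $\nabla^{L,\mu}$ and $\nabla^{L,N}$ be the Levi-Civita connections of $g_\mu$ and $g_2$. For a connection $\nabla$ let $$R(X,Y)Z=\nabla_X\nabla_YZ-(-1)^{|X||Y|}\nabla_Y\nabla_XZ-\nabla_{[X,Y]}Z,$$ $$\mathrm{Ric}(X,Y)=\sum_I(-1)^{|\partial_I|(|\partial_I|+|X|+|Y|)}\tfrac12\left[R(\partial_I,X)Y+(-1)^{|X||Y|}R(\partial_I,Y)X\right]^I,$$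 where $\partial_I$ are the coordinate vector fields and $[\ ]^I$ is the (left) coefficient of $\partial_I$; a supermanifold with a metric $g$ and a connection is called Einstein with Einstein constant $c\in\mathbb{R}$ if $\mathrm{Ric}=c\,g$. Then, for $\lambda\in\mathbb{R}$, $(M_2,g_\mu,\nabla^{L,\mu})$ is Einstein with the Einstein constant $\lambda$ if and only if $\lambda=0$ and one of the following conditions holds: (1) $q=n$, and for some constant $c_0\in\mathbb{R}$, $(N,\nabla^{L,N})$ is Einstein with the Einstein constant $-c_0$ and $hh''-(h')^2=c_0$ on $\mathbb{R}$. (2) $q-n-1=0$, $(N,\nabla^{L,N})$ is Einstein with the Einstein constant $0$, and $h=c_1t+c_2$ for some constants $c_1,c_2\in\mathbb{R}$. (3) $q-n-1\neq 0,-1$, and for some constants $c_0,c_2\in\mathbb{R}$, $(N,\nabla^{L,N})$ is Einstein with the Einstein constant $-c_0$, $\frac{c_0}{q-n-1}\geq 0$, and $h=\sqrt{\frac{c_0}{q-n-1}}\,t+c_2$ or $h=-\sqrt{\frac{c_0}{q-n-1}}\,t+c_2$. -/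

import Mathlib

open scoped ContDiff

universe u v u' v'

namespace SuperGeometry

noncomputable section

section Superdomains

variable {α β α' β' : Type*} [Fintype α] [DecidableEq α] [Fintype β] [DecidableEq β]
  [Fintype α'] [DecidableEq α'] [Fintype β'] [DecidableEq β']

/-- The real Grassmann algebra on the odd generators `ξ^A`, `A : β`. -/
abbrev Grassmann (β : Type*) := ExteriorAlgebra ℝ (β → ℝ)

instance grassmann_finite (β : Type*) [Finite β] : Module.Finite ℝ (Grassmann β) := by
  classical
  let _ := Fintype.ofFinite β
  let _ : LinearOrder β := linearOrderOfSTO WellOrderingRel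
  exact Module.Finite.of_basis (Pi.basisFun ℝ β).ExteriorAlgebra

/-- Superfunctions in even coordinates `x^a`, `a : α`, and odd coordinates `ξ^A`, `A : β`: functions
of `x` with values in the Grassmann algebra. The smooth ones on an open `U ⊆ ℝ^α` (see
`SmoothOn`) form `C^∞(U) ⊗ Λℝ^β`; values outside `U` are irrelevant. -/
abbrev SFun (α β : Type*) := (α → ℝ) → Grassmann β

/-- All components of `f` with respect to a basis of the Grassmann algebra are smooth on `U`. -/
def SmoothOn (f : SFun α β) (U : Set (α → ℝ)) : Prop :=
  ∀ l : Grassmann β →ₗ[ℝ] ℝ, ContDiffOn ℝ ∞ (fun x => l (f x)) U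

/-- Parity of a coordinate: `0` for the even and `1` for the odd coordinates. -/
def parity : α ⊕ β → ℕ
  | Sum.inl _ => 0
  | Sum.inr _ => 1

/-- The sign `(-1)^k`, as a real number. -/
def sgn (k : ℕ) : ℝ := (-1) ^ k

/-- `twist k u = (-1)^{k|u|} u` for homogeneous `u`, extended additively to all `u`. -/
def twist (k : ℕ) (u : Grassmann β) : Grassmann β := CliffordAlgebra.involute^[k] u

/-- `u` is homogeneous of parity `k mod 2`. -/
def HasParity (k : ℕ) (u : Grassmann β) : Prop := CliffordAlgebra.involute u = sgn k • u

/-- The coordinates `(x^a, ξ^A)` themselves, as superfunctions. -/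
def coord : α ⊕ β → SFun α β
  | Sum.inl a => fun x => algebraMap ℝ _ (x a)
  | Sum.inr A => fun _ => ExteriorAlgebra.ι ℝ (Pi.single A 1)

/-- The partial derivative in the even direction `a`, taken component by component (in an arbitrary
basis of the Grassmann algebra, on which the result does not depend). -/
def evenDeriv (a : α) (f : SFun α β) : SFun α β := fun x =>
  ∑ k, fderiv ℝ (fun z => (Module.finBasis ℝ (Grassmann β)).repr (f z) k) x (Pi.single a 1) •
    Module.finBasis ℝ (Grassmann β) k

/-- The coordinate derivations `∂_I`: the partial derivative in an even direction, the left
derivative in an odd direction. -/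
def pd : α ⊕ β → SFun α β → SFun α β
  | Sum.inl a => evenDeriv a
  | Sum.inr A => fun f x => CliffordAlgebra.contractLeft (LinearMap.proj A) (f x)

/-- The substitution `ξ^A ↦ θ^A` of odd elements for the generators: the homomorphism of algebras
with these values on the generators. (It exists whenever all `θ^A` are odd.) -/
def oddSubst (θ : β' → Grassmann β) (u : Grassmann β') : Grassmann β :=
  open Classical in
  if h : ∀ v, Fintype.linearCombination ℝ θ v * Fintype.linearCombination ℝ θ v = 0
  then ExteriorAlgebra.lift ℝ ⟨Fintype.linearCombination ℝ θ, h⟩ u else 0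

/-- The body of an element of the Grassmann algebra (the generators are put equal to zero). -/
def body (u : Grassmann β) : ℝ := ExteriorAlgebra.algebraMapInv u

/-- The pull-back `φ^* f` of a superfunction along the morphism `φ` of superdomains that has
the coordinate expressions `y^I` (`y^a` even, `y^A` odd). The even arguments
`y^a = b^a + (y^a - b^a)`, with `b^a` the body, are inserted by the Taylor expansion of `f` at `b`,
which terminates because products of more than `|β|` of the `y^a - b^a` vanish. -/
def pullback (y : α' ⊕ β' → SFun α β) (f : SFun α' β') : SFun α β := fun x =>
  ∑ m ∈ Finset.range (Fintype.card β + 1), ((m.factorial : ℝ)⁻¹) •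
    ∑ a : Fin m → α',
      oddSubst (fun A => y (Sum.inr A) x)
          ((List.ofFn a).foldr evenDeriv f (fun c => body (y (Sum.inl c) x))) *
        (List.ofFn fun k =>
          y (Sum.inl (a k)) x - algebraMap ℝ _ (body (y (Sum.inl (a k)) x))).prod

/-- Components of vector fields: `X = ∑ X^I ∂_I`. -/
abbrev VF (α β : Type*) := α ⊕ β → SFun α β

/-- The coordinate vector field `∂_K`. -/
def frame (K : α ⊕ β) : VF α β := fun L _ => if L = K then 1 else 0

/-- `⟨X, Y⟩_g` for the even bilinear form with `⟨∂_I, ∂_J⟩_g = g_{IJ}`, which is left linear in `X`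
and satisfies `⟨X, f Y⟩ = (-1)^{|X||f|} f ⟨X, Y⟩`. -/
def pairing (g : α ⊕ β → α ⊕ β → SFun α β) (X Y : VF α β) : SFun α β := fun x =>
  ∑ I, ∑ J, X I x * twist (parity I) (Y J x) * g I J x

/-- `∇_{∂_I} Y` for the affine connection with `∇_{∂_I} ∂_J = ∑ Γ_{IJ}^K ∂_K`; by the Leibniz rule
`∇_{∂_I}(f ∂_J) = (∂_I f) ∂_J + (-1)^{|I||f|} f ∇_{∂_I} ∂_J`. Here `Γ I J K` is `Γ_{IJ}^K`. -/
def covDeriv (Γ : α ⊕ β → α ⊕ β → VF α β) (I : α ⊕ β) (Y : VF α β) : VF α β := fun K x =>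
  pd I (Y K) x + ∑ J, twist (parity I) (Y J x) * Γ I J K x

/-- `R(∂_I, ∂_J) ∂_K = ∇_I ∇_J ∂_K - (-1)^{|I||J|} ∇_J ∇_I ∂_K` (note that `[∂_I, ∂_J] = 0`). -/
def curvature (Γ : α ⊕ β → α ⊕ β → VF α β) (I J K : α ⊕ β) : VF α β := fun L x =>
  covDeriv Γ I (covDeriv Γ J (frame K)) L x
    - sgn (parity I * parity J) • covDeriv Γ J (covDeriv Γ I (frame K)) L x

/-- The components `Ric(∂_J, ∂_K)` of the (supersymmetrized) Ricci tensor, the supertrace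
`∑_I (-1)^{|I|(|I|+|J|+|K|)} ½ [R(∂_I,∂_J)∂_K + (-1)^{|J||K|} R(∂_I,∂_K)∂_J]^I`. -/
def ricci (Γ : α ⊕ β → α ⊕ β → VF α β) (J K : α ⊕ β) : SFun α β := fun x =>
  ∑ I, sgn (parity I * (parity I + parity J + parity K)) • (1 / 2 : ℝ) •
    (curvature Γ I J K I x + sgn (parity J * parity K) • curvature Γ I K J I x)

end Superdomains

/-- The data of a supermanifold glued from superdomains with even coordinates indexed by `α` and odd
coordinates indexed by `β`: the underlying topological space, charts of it, and for any two charts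
the coordinate transformation; `trans i j I` is the `I`-th coordinate of the chart `j` written as
a superfunction of the coordinates of the chart `i`. -/
structure SuperAtlas (α β : Type*) where
  Pt : Type u
  [top : TopologicalSpace Pt]
  Idx : Type v
  chart : Idx → OpenPartialHomeomorph Pt (α → ℝ)
  trans : Idx → Idx → α ⊕ β → SFun α β

attribute [instance] SuperAtlas.top

section Supermanifolds

variable {α β α' β' : Type*} [Fintype α] [DecidableEq α] [Fintype β] [DecidableEq β]
  [Fintype α'] [DecidableEq α'] [Fintype β'] [DecidableEq β']

/-- The part of the coordinate domain of the chart `i` that is also covered by the chart `j`. -/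
def SuperAtlas.overlap (S : SuperAtlas α β) (i j : S.Idx) : Set (α → ℝ) :=
  (S.chart i).target ∩ (S.chart i).symm ⁻¹' (S.chart j).source

/-- The data define a supermanifold: the underlying space is Hausdorff and second countable
and covered by the charts, the coordinate transformations are morphisms of superdomains over the
coordinate changes of the underlying space, and they satisfy the cocycle conditions. -/
structure SuperAtlas.IsSupermanifold (S : SuperAtlas α β) : Prop where
  t2 : T2Space S.Pt
  secondCountable : SecondCountableTopology S.Pt
  cover : ∀ p : S.Pt, ∃ i, p ∈ (S.chart i).source
  trans_smooth : ∀ i j I, SmoothOn (S.trans i j I) (S.overlap i j)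
  trans_parity : ∀ i j I, ∀ x ∈ S.overlap i j, HasParity (parity I) (S.trans i j I x)
  trans_body : ∀ i j a, ∀ x ∈ S.overlap i j,
    body (S.trans i j (Sum.inl a) x) = S.chart j ((S.chart i).symm x) a
  trans_refl : ∀ i I, ∀ x ∈ (S.chart i).target, S.trans i i I x = coord I x
  cocycle : ∀ i j k I, ∀ x ∈ S.overlap i j ∩ S.overlap i k,
    S.trans i k I x = pullback (S.trans i j) (S.trans j k I) x

/-- Families of components `⟨∂_I, ∂_J⟩_g`, one matrix for every chart. -/
abbrev SuperAtlas.Form (S : SuperAtlas α β) := S.Idx → α ⊕ β → α ⊕ β → SFun α β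

/-- The components define an even Riemannian metric (of any signature) on the supermanifold: they
are smooth, even, supersymmetric, nondegenerate, and transform as a covariant tensor. -/
structure IsMetric (S : SuperAtlas α β) (g : S.Form) : Prop where
  smooth : ∀ i I J, SmoothOn (g i I J) (S.chart i).target
  even : ∀ i I J, ∀ x ∈ (S.chart i).target, HasParity (parity I + parity J) (g i I J x)
  symm : ∀ i I J, ∀ x ∈ (S.chart i).target,
    g i I J x = sgn (parity I * parity J) • g i J I x
  nondegenerate : ∀ i, ∀ x ∈ (S.chart i).target,
    IsUnit (Matrix.of fun I J => g i I J x : Matrix (α ⊕ β) (α ⊕ β) (Grassmann β))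
  transform : ∀ i j I J, ∀ x ∈ S.overlap i j,
    g i I J x = ∑ K, ∑ L, pd I (S.trans i j K) x * twist (parity K) (pd J (S.trans i j L) x) *
      pullback (S.trans i j) (g j K L) x

/-- Families of Christoffel symbols `Γ_{IJ}^K`, one for every chart. -/
abbrev SuperAtlas.Conn (S : SuperAtlas α β) := S.Idx → α ⊕ β → α ⊕ β → VF α β

/-- The Levi-Civita connection of `g`: in every chart it is smooth, preserves the degree, has no
torsion, and is compatible with the metric. (On coordinate vector fields the brackets vanish. The
torsion is a tensor, and so is the defect of metric compatibility, hence the conditions on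
coordinate vector fields suffice. The conditions determine the Christoffel symbols in every chart,
so that these transform automatically as the Christoffel symbols of one affine connection.) -/
structure IsLeviCivita (S : SuperAtlas α β) (g : S.Form) (Γ : S.Conn) : Prop where
  smooth : ∀ i I J K, SmoothOn (Γ i I J K) (S.chart i).target
  even : ∀ i I J K, ∀ x ∈ (S.chart i).target,
    HasParity (parity I + parity J + parity K) (Γ i I J K x)
  torsionFree : ∀ i I J K, ∀ x ∈ (S.chart i).target,
    covDeriv (Γ i) I (frame J) K x = sgn (parity I * parity J) • covDeriv (Γ i) J (frame I) K x
  metric : ∀ i I J K, ∀ x ∈ (S.chart i).target,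
    pd I (g i J K) x = pairing (g i) (covDeriv (Γ i) I (frame J)) (frame K) x
      + sgn (parity I * parity J) • pairing (g i) (frame J) (covDeriv (Γ i) I (frame K)) x

/-- `(S, g, ∇)` is Einstein with Einstein constant `c`: `Ric = c g`. Both sides are tensors, so it
is enough to compare them on coordinate vector fields. -/
def IsEinstein (S : SuperAtlas α β) (g : S.Form) (Γ : S.Conn) (c : ℝ) : Prop :=
  ∀ i J K, ∀ x ∈ (S.chart i).target, ricci (Γ i) J K x = c • g i J K x

/-! Products -/

/-- The pull-back of a superfunction to a product along the first projection. -/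
def pr₁ (f : SFun α β) : SFun (α ⊕ α') (β ⊕ β') := fun z =>
  ExteriorAlgebra.map ((LinearEquiv.sumArrowLequivProdArrow β β' ℝ ℝ).symm.toLinearMap ∘ₗ
    LinearMap.inl ℝ (β → ℝ) (β' → ℝ)) (f fun a => z (Sum.inl a))

/-- The pull-back of a superfunction to a product along the second projection. -/
def pr₂ (f : SFun α' β') : SFun (α ⊕ α') (β ⊕ β') := fun z =>
  ExteriorAlgebra.map ((LinearEquiv.sumArrowLequivProdArrow β β' ℝ ℝ).symm.toLinearMap ∘ₗ
    LinearMap.inr ℝ (β → ℝ) (β' → ℝ)) (f fun a => z (Sum.inr a))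

/-- The coordinates of a product belong to either the first or the second factor. -/
def factor : (α ⊕ α') ⊕ (β ⊕ β') → (α ⊕ β) ⊕ (α' ⊕ β') := Equiv.sumSumSumComm α α' β β'

/-- The product of two supermanifolds, with the products of charts as charts. -/
def SuperAtlas.prod (S : SuperAtlas.{u, v} α β) (T : SuperAtlas.{u', v'} α' β') :
    SuperAtlas.{max u u', max v v'} (α ⊕ α') (β ⊕ β') where
  Pt := S.Pt × T.Pt
  Idx := S.Idx × T.Idx
  chart i := ((S.chart i.1).prod (T.chart i.2)).transHomeomorph
    Homeomorph.sumArrowHomeomorphProdArrow.symm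
  trans i j I := match factor I with
    | Sum.inl K => pr₁ (S.trans i.1 j.1 K)
    | Sum.inr L => pr₂ (T.trans i.2 j.2 L)

/-- The metric `π₁^* g₁ + (π₁^* μ) π₂^* g₂` of the warped product, where the superfunction `μ` on
the first factor is given by its expressions in the charts. -/
def warped {S : SuperAtlas.{u, v} α β} {T : SuperAtlas.{u', v'} α' β'} (g₁ : S.Form)
    (μ : S.Idx → SFun α β) (g₂ : T.Form) : (S.prod T).Form := fun i I J =>
  match factor I, factor J with
    | Sum.inl K, Sum.inl L => pr₁ (g₁ i.1 K L)
    | Sum.inr K, Sum.inr L => pr₁ (μ i.1) * pr₂ (g₂ i.2 K L)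
    | _, _ => 0

end Supermanifolds

/-- The supermanifold `ℝ^{(1,2)}` with global coordinates `(t, ξ, η)`. -/
def R12 : SuperAtlas.{0, 0} (Fin 1) (Fin 2) where
  Pt := Fin 1 → ℝ
  Idx := Unit
  chart _ := OpenPartialHomeomorph.refl _
  trans _ _ := coord

/-- The metric `-dt ⊗ dt + dξ ⊗ dη - dη ⊗ dξ` on `ℝ^{(1,2)}`, that is, `⟨∂_t, ∂_t⟩ = -1`,
`⟨∂_ξ, ∂_η⟩ = -1`, `⟨∂_η, ∂_ξ⟩ = 1`, and zero for the other pairs. -/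
def gR12 : R12.Form := fun _ I J _ =>
  match I, J with
    | Sum.inl _, Sum.inl _ => -1
    | Sum.inr 0, Sum.inr 1 => -1
    | Sum.inr 1, Sum.inr 0 => 1
    | _, _ => 0

/-- A function `f(t)` as a superfunction on `ℝ^{(1,2)}`. -/
def ofTime (f : ℝ → ℝ) : R12.Idx → SFun (Fin 1) (Fin 2) := fun _ x => algebraMap ℝ _ (f (x 0))

end

end SuperGeometry

open SuperGeometry

set_option linter.unusedSectionVars false

namespace SuperGeometry

/-! Signs and parities -/

/-! The Levi-Civita connection of the warped product can be written down explicitly. Apart from the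
symbols of `N`, its only nonzero Christoffel symbols in a product chart are `Γ_{tV}^W = Γ_{Vt}^W =
(h'/h) δ_V^W` and `Γ_{VW}^t = h h' g_{VW}`, where `V, W` are fibre indices and `g = g₂`; the last
one has a plus sign because `⟨∂_t, ∂_t⟩ = -1`. `leviCivitaAt_warpedConn` checks this. The Koszul
argument of `LeviCivitaAt.unique`, with `warpedForm_nondegenerate`, shows that any Levi-Civita
connection of the warped metric has these symbols.

The Ricci tensor then has three kinds of components. Those with an index `ξ` or `η`, and the mixed
ones between `t` and the fibre, vanish. `Ric(∂_t, ∂_t) = -(q - n) h''/h`, where `q - n` arises as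
the supertrace of the identity of the fibre. On the fibre, `Ric = Ric_N + (h h'' + (q - n - 1) h'²)
g₂` (`ricci_fibIdx_fibIdx`).

Since `Ric(∂_ξ, ∂_η) = 0` while the metric is `-1` there, the Einstein constant must be zero. What
remains is `(q - n) h'' = 0`, together with the condition that `h h'' + (q - n - 1) h'²` is a
constant `c₀` and `N` is Einstein with constant `-c₀` (`isEinstein_warped_iff`). For `q = n` this is
condition (1). Otherwise `h` is affine with slope `a` and `c₀ = (q - n - 1) a²`, which gives (2) or
(3). -/

lemma sgn_add (a b : ℕ) : sgn (a + b) = sgn a * sgn b := pow_add _ _ _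

lemma sgn_mul_self (a : ℕ) : sgn a * sgn a = 1 := by
  rw [← sgn_add, sgn, Even.neg_one_pow ⟨a, rfl⟩]

lemma sgn_zero : sgn 0 = 1 := pow_zero _

lemma sgn_mul_add (a b c : ℕ) : sgn (a * (b + c)) = sgn (a * b) * sgn (a * c) := by
  rw [mul_add, sgn_add]

lemma sgn_sq (a : ℕ) : sgn (a * a) = sgn a := by
  rcases Nat.even_or_odd a with h | h
  · rw [sgn, sgn, (h.mul_left a).neg_one_pow, h.neg_one_pow]
  · rw [sgn, sgn, (h.mul h).neg_one_pow, h.neg_one_pow]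

section Twist

variable {β : Type*}

lemma twist_zero (u : Grassmann β) : twist 0 u = u := rfl

lemma twist_map_zero (k : ℕ) : twist k (0 : Grassmann β) = 0 := by
  induction k with
  | zero => rfl
  | succ k ih => rw [twist, Function.iterate_succ_apply, map_zero]; exact ih

lemma twist_map_one (k : ℕ) : twist k (1 : Grassmann β) = 1 := by
  induction k with
  | zero => rfl
  | succ k ih => rw [twist, Function.iterate_succ_apply, map_one]; exact ih

lemma twist_smul (k : ℕ) (r : ℝ) (u : Grassmann β) : twist k (r • u) = r • twist k u := by
  induction k generalizing u with
  | zero => rfl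
  | succ k ih =>
    rw [twist, Function.iterate_succ_apply, map_smul]
    exact ih _

/-- Metric components and Christoffel symbols are homogeneous, so their twists become real signs and
the sign bookkeeping takes place in `ℝ`. -/
lemma HasParity.twist {p : ℕ} {u : Grassmann β} (hu : HasParity p u) (k : ℕ) :
    twist k u = sgn (k * p) • u := by
  induction k with
  | zero => simp [twist_zero, sgn]
  | succ k ih =>
    have h : SuperGeometry.twist (k + 1) u
        = CliffordAlgebra.involute (SuperGeometry.twist k u) :=
      Function.iterate_succ_apply' _ _ _
    rw [h, ih, map_smul, hu, smul_smul, add_mul, one_mul, sgn_add]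

lemma HasParity.zero (p : ℕ) : HasParity p (0 : Grassmann β) := by
  simp [HasParity]

lemma HasParity.one {p : ℕ} (hp : sgn p = 1) : HasParity p (1 : Grassmann β) := by
  simp [HasParity, hp]

lemma HasParity.smul {p : ℕ} {u : Grassmann β} (hu : HasParity p u) (r : ℝ) :
    HasParity p (r • u) := by
  rw [HasParity, map_smul, hu, smul_comm]

end Twist

/-! Derivatives -/

section Derivatives

variable {α β : Type*} [Fintype α] [DecidableEq α] [Fintype β] [DecidableEq β]

/-- All components of `f` are differentiable at `x`. -/
def DiffAt (f : SFun α β) (x : α → ℝ) : Prop :=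
  ∀ l : Grassmann β →ₗ[ℝ] ℝ, DifferentiableAt ℝ (fun z => l (f z)) x

lemma SmoothOn.diffAt {f : SFun α β} {U : Set (α → ℝ)} (hf : SmoothOn f U) (hU : IsOpen U)
    {x : α → ℝ} (hx : x ∈ U) : DiffAt f x := fun l =>
  ((hf l).contDiffAt (hU.mem_nhds hx)).differentiableAt (by simp)

/-- Testing with a linear functional removes the basis chosen in `evenDeriv`. Together with
`eq_of_forall_dual` this reduces identities for even derivatives to scalar calculus. -/
lemma apply_evenDeriv {f : SFun α β} {x : α → ℝ} (hf : DiffAt f x) (a : α)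
    (l : Grassmann β →ₗ[ℝ] ℝ) :
    l (evenDeriv a f x) = fderiv ℝ (fun z => l (f z)) x (Pi.single a 1) := by
  set b := Module.finBasis ℝ (Grassmann β) with hb
  have h1 : (fun z => l (f z)) = fun z => ∑ k, b.repr (f z) k * l (b k) := by
    funext z
    conv_lhs => rw [← b.sum_repr (f z)]
    simp only [map_sum, map_smul, smul_eq_mul]
  have hd : ∀ k, DifferentiableAt ℝ (fun z => b.repr (f z) k) x := fun k => hf (b.coord k)
  rw [h1, fderiv_fun_sum (fun k _ => (hd k).mul_const _)]
  simp only [evenDeriv, map_sum, map_smul, smul_eq_mul, sum_apply, ← hb]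
  refine Finset.sum_congr rfl fun k _ => ?_
  rw [fderiv_mul_const (hd k)]
  simp [mul_comm]

lemma eq_of_forall_dual {u v : Grassmann β} (h : ∀ l : Grassmann β →ₗ[ℝ] ℝ, l u = l v) :
    u = v := by
  apply (Module.finBasis ℝ (Grassmann β)).repr.injective
  ext k
  exact h ((Module.finBasis ℝ (Grassmann β)).coord k)

lemma pd_congr {f g : SFun α β} {x : α → ℝ} (h : f =ᶠ[nhds x] g) (I : α ⊕ β) :
    pd I f x = pd I g x := by
  rcases I with a | A
  · simp only [pd, evenDeriv]
    refine Finset.sum_congr rfl fun k _ => ?_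
    have e : (fun z => (Module.finBasis ℝ (Grassmann β)).repr (f z) k) =ᶠ[nhds x]
        fun z => (Module.finBasis ℝ (Grassmann β)).repr (g z) k :=
      h.fun_comp fun u => (Module.finBasis ℝ (Grassmann β)).repr u k
    rw [e.fderiv_eq]
  · simp only [pd, h.self_of_nhds]

lemma pd_const_real (r : ℝ) (I : α ⊕ β) (x : α → ℝ) :
    pd I (fun _ => algebraMap ℝ (Grassmann β) r : SFun α β) x = 0 := by
  rcases I with a | A
  · simp [pd, evenDeriv]
  · simp [pd]

lemma pd_zero (I : α ⊕ β) (x : α → ℝ) : pd I (fun _ => 0 : SFun α β) x = 0 := by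
  simpa using pd_const_real 0 I x

lemma pd_one (I : α ⊕ β) (x : α → ℝ) : pd I (fun _ => 1 : SFun α β) x = 0 := by
  simpa using pd_const_real 1 I x

end Derivatives

/-! Covariant derivatives and the uniqueness of the Levi-Civita connection -/

section Connections

variable {α β : Type*} [Fintype α] [DecidableEq α] [Fintype β] [DecidableEq β]

lemma twist_frame (k : ℕ) (J L : α ⊕ β) (x : α → ℝ) :
    twist k (frame J L x) = frame J L x := by
  unfold frame
  split_ifs
  · exact twist_map_one _
  · exact twist_map_zero _

lemma covDeriv_frame (Γ : α ⊕ β → α ⊕ β → VF α β) (I J : α ⊕ β) :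
    covDeriv Γ I (frame J) = Γ I J := by
  funext K x
  have h' : pd I (frame J K) x = 0 := by
    by_cases hK : K = J
    · have : frame J K = fun _ => 1 := by funext y; simp [frame, hK]
      rw [this, pd_one]
    · have : frame J K = fun _ => 0 := by funext y; simp [frame, hK]
      rw [this, pd_zero]
  simp only [covDeriv, h', twist_frame, zero_add]
  simp [frame]

lemma curvature_apply (Γ : α ⊕ β → α ⊕ β → VF α β) (I J K L : α ⊕ β) (x : α → ℝ) :
    curvature Γ I J K L x =
      (pd I (Γ J K L) x + ∑ M, twist (parity I) (Γ J K M x) * Γ I M L x)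
      - sgn (parity I * parity J) •
        (pd J (Γ I K L) x + ∑ M, twist (parity J) (Γ I K M x) * Γ J M L x) := by
  rw [curvature, covDeriv_frame, covDeriv_frame]
  rfl

/-- The curvature contains first derivatives of the Christoffel symbols, so agreement near `x`, not
only at `x`, is required. -/
lemma ricci_congr {Γ Γ' : α ⊕ β → α ⊕ β → VF α β} {x : α → ℝ}
    (h : ∀ᶠ y in nhds x, ∀ I J K, Γ I J K y = Γ' I J K y) (J K : α ⊕ β) :
    ricci Γ J K x = ricci Γ' J K x := by
  have hc : ∀ I J K L, curvature Γ I J K L x = curvature Γ' I J K L x := by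
    intro I J K L
    have hx := h.self_of_nhds
    have hp : ∀ I J K L, pd I (Γ J K L) x = pd I (Γ' J K L) x := fun I J K L =>
      pd_congr (h.mono fun y hy => hy J K L) I
    simp only [curvature_apply, hp, hx]
  simp only [ricci, hc]

/-- The conditions on the Christoffel symbols of a Levi-Civita connection at one point. -/
structure LeviCivitaAt (g : α ⊕ β → α ⊕ β → SFun α β) (Γ : α ⊕ β → α ⊕ β → VF α β)
    (x : α → ℝ) : Prop where
  even : ∀ I J K, HasParity (parity I + parity J + parity K) (Γ I J K x)
  torsionFree : ∀ I J K, Γ I J K x = sgn (parity I * parity J) • Γ J I K x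
  metric : ∀ I J K, pd I (g J K) x =
    ∑ L, Γ I J L x * g L K x + sgn (parity J * parity K) • ∑ L, Γ I K L x * g L J x

lemma pairing_frame_right (g : α ⊕ β → α ⊕ β → SFun α β) (X : VF α β) (K : α ⊕ β) (x : α → ℝ) :
    pairing g X (frame K) x = ∑ L, X L x * g L K x := by
  unfold pairing
  refine Finset.sum_congr rfl fun L _ => ?_
  rw [Finset.sum_eq_single K]
  · simp [frame, twist_map_one]
  · intro M _ hM
    simp [frame, hM, twist_map_zero]
  · simp

lemma pairing_frame_left (g : α ⊕ β → α ⊕ β → SFun α β) (J : α ⊕ β) (Y : VF α β) (x : α → ℝ) :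
    pairing g (frame J) Y x = ∑ L, twist (parity J) (Y L x) * g J L x := by
  unfold pairing
  rw [Finset.sum_eq_single J]
  · simp [frame]
  · intro M _ hM
    simp [frame, hM]
  · simp

/-- In the second pairing the supersymmetry of `g` moves the Christoffel symbol to the index
contracted on the left. The sign of the twist combines with the others to `(-1)^{|J||K|}`, and both
terms take the same form. -/
lemma IsLeviCivita.leviCivitaAt {S : SuperAtlas α β} {g : S.Form} {Γ : S.Conn}
    (hΓ : IsLeviCivita S g Γ) (i : S.Idx) {x : α → ℝ} (hx : x ∈ (S.chart i).target)
    (hg : ∀ I J, g i I J x = sgn (parity I * parity J) • g i J I x) :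
    LeviCivitaAt (g i) (Γ i) x where
  even I J K := hΓ.even i I J K x hx
  torsionFree I J K := by
    simpa only [covDeriv_frame] using hΓ.torsionFree i I J K x hx
  metric I J K := by
    have h := hΓ.metric i I J K x hx
    rw [covDeriv_frame, covDeriv_frame, pairing_frame_right, pairing_frame_left] at h
    rw [h, Finset.smul_sum, Finset.smul_sum]
    congr 1
    refine Finset.sum_congr rfl fun L _ => ?_
    rw [(hΓ.even i I K L x hx).twist, hg J L, smul_mul_assoc, mul_smul_comm, smul_smul, smul_smul]
    congr 1
    rw [sgn_mul_add, sgn_mul_add, mul_comm (parity J) (parity I)]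
    linear_combination (sgn (parity J * parity K) * sgn (parity J * parity L)
      * sgn (parity J * parity L)) * sgn_mul_self (parity I * parity J)
      + sgn (parity J * parity K) * sgn_mul_self (parity J * parity L)

/-- Koszul's argument: the difference of the two connections, with its upper index lowered by `g`,
is supersymmetric in the first two indices and super-skew in the last two, hence zero. Nondegeneracy
enters only as injectivity of lowering the index. -/
lemma LeviCivitaAt.unique {g : α ⊕ β → α ⊕ β → SFun α β} {Γ Γ' : α ⊕ β → α ⊕ β → VF α β}
    {x : α → ℝ} (h : LeviCivitaAt g Γ x) (h' : LeviCivitaAt g Γ' x)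
    (hg : ∀ v : α ⊕ β → Grassmann β, (∀ K, ∑ L, v L * g L K x = 0) → v = 0) (I J K : α ⊕ β) :
    Γ I J K x = Γ' I J K x := by
  set D : α ⊕ β → α ⊕ β → α ⊕ β → Grassmann β := fun I J K =>
    ∑ L, (Γ I J L x - Γ' I J L x) * g L K x with hD
  have h1 : ∀ I J K, D I J K = sgn (parity I * parity J) • D J I K := by
    intro I J K
    simp only [hD, Finset.smul_sum]
    refine Finset.sum_congr rfl fun L _ => ?_
    rw [h.torsionFree I J, h'.torsionFree I J, ← smul_sub, smul_mul_assoc]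
  have h2 : ∀ I J K, D I J K = -(sgn (parity J * parity K) • D I K J) := by
    intro I J K
    have e := (h.metric I J K).symm.trans (h'.metric I J K)
    simp only [hD, sub_mul, Finset.sum_sub_distrib, smul_sub]
    rw [eq_neg_iff_add_eq_zero, sub_add_sub_comm, e, sub_self]
  have h0 : ∀ I J K, D I J K = 0 := by
    intro I J K
    have e : D I J K = -D I J K := by
      -- Six alternating transpositions return to the order `I J K`. Each of the three pairs is
      -- exchanged twice, so the parity signs cancel, while the three skew exchanges leave a factor
      -- `-1`.
      conv_lhs => rw [h2 I J K, h1 I K J, h2 K I J, h1 K J I, h2 J K I, h1 J I K]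
      simp only [smul_neg, smul_smul, neg_neg]
      congr 1
      conv_rhs => rw [← one_smul ℝ (D I J K)]
      congr 1
      rw [mul_comm (parity K) (parity J), mul_comm (parity K) (parity I),
        mul_comm (parity J) (parity I)]
      have a := sgn_mul_self (parity I * parity J)
      have b := sgn_mul_self (parity J * parity K)
      have c := sgn_mul_self (parity I * parity K)
      calc _ = (sgn (parity I * parity J) * sgn (parity I * parity J)) *
            (sgn (parity J * parity K) * sgn (parity J * parity K)) *
            (sgn (parity I * parity K) * sgn (parity I * parity K)) := by ring
        _ = 1 := by rw [a, b, c]; norm_num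
    have e2 : (2 : ℝ) • D I J K = 0 := by
      rw [two_smul]
      nth_rewrite 1 [e]
      exact neg_add_cancel _
    exact (smul_eq_zero.mp e2).resolve_left two_ne_zero
  have := hg (fun L => Γ I J L x - Γ' I J L x) (fun K => h0 I J K)
  exact sub_eq_zero.mp (congrFun this K)

end Connections

/-! Products of `ℝ^{(1,2)}` with a superdomain -/

section Product

variable {α β : Type*} [Fintype α] [DecidableEq α] [Fintype β] [DecidableEq β]

/-- The index of the coordinate `t` of the first factor. -/
def timeIdx : (Fin 1 ⊕ α) ⊕ (Fin 2 ⊕ β) := Sum.inl (Sum.inl 0)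

/-- The indices of the coordinates `ξ`, `η` of the first factor. -/
def oddIdx (A : Fin 2) : (Fin 1 ⊕ α) ⊕ (Fin 2 ⊕ β) := Sum.inr (Sum.inl A)

/-- The indices of the coordinates of the second factor. -/
def fibIdx : α ⊕ β → (Fin 1 ⊕ α) ⊕ (Fin 2 ⊕ β)
  | Sum.inl a => Sum.inl (Sum.inr a)
  | Sum.inr B => Sum.inr (Sum.inr B)

lemma idx_cases (I : (Fin 1 ⊕ α) ⊕ (Fin 2 ⊕ β)) :
    I = timeIdx ∨ (∃ A, I = oddIdx A) ∨ ∃ V, I = fibIdx V := by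
  rcases I with (a | a) | (b | b)
  · left
    rw [Subsingleton.elim a 0]
    rfl
  · exact Or.inr (Or.inr ⟨Sum.inl a, rfl⟩)
  · exact Or.inr (Or.inl ⟨b, rfl⟩)
  · exact Or.inr (Or.inr ⟨Sum.inr b, rfl⟩)

@[simp] lemma factor_timeIdx :
    factor (timeIdx : (Fin 1 ⊕ α) ⊕ (Fin 2 ⊕ β)) = Sum.inl (Sum.inl 0) := rfl

@[simp] lemma factor_oddIdx (A : Fin 2) :
    factor (oddIdx A : (Fin 1 ⊕ α) ⊕ (Fin 2 ⊕ β)) = Sum.inl (Sum.inr A) := rfl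

@[simp] lemma factor_fibIdx (V : α ⊕ β) : factor (fibIdx V) = Sum.inr V := by
  cases V <;> rfl

@[simp] lemma parity_timeIdx : parity (timeIdx : (Fin 1 ⊕ α) ⊕ (Fin 2 ⊕ β)) = 0 := rfl

@[simp] lemma parity_oddIdx (A : Fin 2) :
    parity (oddIdx A : (Fin 1 ⊕ α) ⊕ (Fin 2 ⊕ β)) = 1 := rfl

@[simp] lemma parity_fibIdx (V : α ⊕ β) : parity (fibIdx V) = parity V := by
  cases V <;> rfl

lemma sum_idx {E : Type*} [AddCommMonoid E] (F : (Fin 1 ⊕ α) ⊕ (Fin 2 ⊕ β) → E) :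
    ∑ I, F I = F timeIdx + ∑ A, F (oddIdx A) + ∑ V, F (fibIdx V) := by
  simp only [Fintype.sum_sum_type, timeIdx, oddIdx, fibIdx, Finset.univ_unique,
    Finset.sum_singleton]
  rw [show (default : Fin 1) = 0 from rfl]
  abel

/-- The inclusion of the odd directions of the second factor. -/
def fibIncl : (β → ℝ) →ₗ[ℝ] (Fin 2 ⊕ β → ℝ) :=
  (LinearEquiv.sumArrowLequivProdArrow (Fin 2) β ℝ ℝ).symm.toLinearMap ∘ₗ
    LinearMap.inr ℝ (Fin 2 → ℝ) (β → ℝ)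

/-- The homomorphism of Grassmann algebras underlying the pull-back along the second
projection. -/
noncomputable def fibMap : Grassmann β →ₐ[ℝ] Grassmann (Fin 2 ⊕ β) :=
  ExteriorAlgebra.map fibIncl

lemma fibMap_ι (v : β → ℝ) :
    fibMap (ExteriorAlgebra.ι ℝ v) = ExteriorAlgebra.ι ℝ (fibIncl v) :=
  ExteriorAlgebra.map_apply_ι _ _

/-- This lets equations between pulled-back superfunctions descend from the product to `N`. -/
lemma fibMap_injective : Function.Injective (fibMap : Grassmann β → Grassmann (Fin 2 ⊕ β)) := by
  refine ExteriorAlgebra.map_injective_field (LinearMap.ker_eq_bot.mpr fun v w hvw => ?_)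
  funext B
  exact congrFun hvw (Sum.inr B)

lemma involute_fibMap (u : Grassmann β) :
    CliffordAlgebra.involute (fibMap u) = fibMap (CliffordAlgebra.involute u) := by
  induction u using CliffordAlgebra.left_induction with
  | algebraMap r => simp
  | add x y hx hy => simp only [map_add, hx, hy]
  | ι_mul x m hx =>
    rw [map_mul, map_mul, map_mul, map_mul, hx, CliffordAlgebra.involute_ι, map_neg]
    erw [fibMap_ι]
    rw [CliffordAlgebra.involute_ι]

lemma twist_fibMap (k : ℕ) (u : Grassmann β) : twist k (fibMap u) = fibMap (twist k u) := by
  induction k generalizing u with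
  | zero => rfl
  | succ k ih =>
    rw [twist, Function.iterate_succ_apply, involute_fibMap]
    exact ih _

lemma HasParity.fibMap {p : ℕ} {u : Grassmann β} (hu : HasParity p u) :
    HasParity p (fibMap u) := by
  rw [HasParity, involute_fibMap, hu, map_smul]

/-- A contraction sees only the values of `d` on the fibre generators. Thus `fibMap` commutes with
the odd derivatives of the fibre, and the derivatives in `ξ` and `η` kill its image. -/
lemma contractLeft_fibMap (d : Module.Dual ℝ (Fin 2 ⊕ β → ℝ)) (u : Grassmann β) :
    CliffordAlgebra.contractLeft d (fibMap u) =
      fibMap (CliffordAlgebra.contractLeft (d ∘ₗ fibIncl) u) := by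
  induction u using CliffordAlgebra.left_induction with
  | algebraMap r => simp
  | add x y hx hy => simp only [map_add, hx, hy]
  | ι_mul x m hx =>
    rw [map_mul fibMap, CliffordAlgebra.contractLeft_ι_mul, map_sub, map_smul,
      map_mul fibMap, ← hx]
    erw [fibMap_ι]
    rw [CliffordAlgebra.contractLeft_ι_mul]
    rfl

lemma contractLeft_fibMap_inr (B : β) (u : Grassmann β) :
    CliffordAlgebra.contractLeft (LinearMap.proj (Sum.inr B)) (fibMap u) =
      fibMap (CliffordAlgebra.contractLeft (LinearMap.proj B) u) :=
  contractLeft_fibMap _ u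

lemma contractLeft_fibMap_inl (A : Fin 2) (u : Grassmann β) :
    CliffordAlgebra.contractLeft (LinearMap.proj (Sum.inl A)) (fibMap u) = 0 := by
  rw [contractLeft_fibMap]
  have : (LinearMap.proj (Sum.inl A) : (Fin 2 ⊕ β → ℝ) →ₗ[ℝ] ℝ) ∘ₗ fibIncl = 0 := by
    ext; rfl
  rw [this, map_zero, LinearMap.zero_apply, map_zero]

/-- The superfunction `φ(t) f` on the product. -/
noncomputable def timeMul (φ : ℝ → ℝ) (f : SFun α β) : SFun (Fin 1 ⊕ α) (Fin 2 ⊕ β) := fun z =>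
  φ (z (Sum.inl 0)) • fibMap (f fun a => z (Sum.inr a))

/-- All components of the warped metric and connection are constants or of the form `timeMul φ f`,
so the rules for `pd` on such products are all the calculus needed on the product. -/
lemma pd_oddIdx_timeMul (φ : ℝ → ℝ) (f : SFun α β) (A : Fin 2) (z : Fin 1 ⊕ α → ℝ) :
    pd (oddIdx A) (timeMul φ f) z = 0 := by
  simp only [oddIdx, pd, timeMul, map_smul, contractLeft_fibMap_inl, smul_zero]

lemma hasFDerivAt_timeMul {φ : ℝ → ℝ} {f : SFun α β} {z : Fin 1 ⊕ α → ℝ}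
    (hφ : DifferentiableAt ℝ φ (z (Sum.inl 0))) (hf : DiffAt f fun a => z (Sum.inr a))
    (l : Grassmann (Fin 2 ⊕ β) →ₗ[ℝ] ℝ) :
    HasFDerivAt (fun z => l (timeMul φ f z))
      (φ (z (Sum.inl 0)) • (fderiv ℝ (fun y => l (fibMap (f y))) fun a => z (Sum.inr a)).comp
          (ContinuousLinearMap.pi fun a => ContinuousLinearMap.proj (Sum.inr a)) +
        l (fibMap (f fun a => z (Sum.inr a))) • (deriv φ (z (Sum.inl 0)) •
          (ContinuousLinearMap.proj (Sum.inl 0) : (Fin 1 ⊕ α → ℝ) →L[ℝ] ℝ))) z := by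
  have h1 : HasFDerivAt (fun z : Fin 1 ⊕ α → ℝ => φ (z (Sum.inl 0)))
      (deriv φ (z (Sum.inl 0)) •
        (ContinuousLinearMap.proj (Sum.inl 0) : (Fin 1 ⊕ α → ℝ) →L[ℝ] ℝ)) z :=
    hφ.hasDerivAt.comp_hasFDerivAt z
      (ContinuousLinearMap.proj (Sum.inl 0) : (Fin 1 ⊕ α → ℝ) →L[ℝ] ℝ).hasFDerivAt
  have h2 := HasFDerivAt.comp z (hf (l ∘ₗ fibMap.toLinearMap)).hasFDerivAt
    (ContinuousLinearMap.pi fun a =>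
      (ContinuousLinearMap.proj (Sum.inr a) : (Fin 1 ⊕ α → ℝ) →L[ℝ] ℝ)).hasFDerivAt
  have h3 := h1.mul h2
  refine h3.congr_of_eventuallyEq (Filter.Eventually.of_forall fun w => ?_)
  simp only [timeMul, map_smul, smul_eq_mul]
  rfl

lemma DiffAt.timeMul {φ : ℝ → ℝ} {f : SFun α β} {z : Fin 1 ⊕ α → ℝ}
    (hφ : DifferentiableAt ℝ φ (z (Sum.inl 0))) (hf : DiffAt f fun a => z (Sum.inr a)) :
    DiffAt (timeMul φ f) z := fun l => (hasFDerivAt_timeMul hφ hf l).differentiableAt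

lemma pd_timeIdx_timeMul {φ : ℝ → ℝ} {f : SFun α β} {z : Fin 1 ⊕ α → ℝ}
    (hφ : DifferentiableAt ℝ φ (z (Sum.inl 0))) (hf : DiffAt f fun a => z (Sum.inr a)) :
    pd timeIdx (timeMul φ f) z
      = deriv φ (z (Sum.inl 0)) • fibMap (f fun a => z (Sum.inr a)) := by
  refine eq_of_forall_dual fun l => ?_
  simp only [timeIdx, pd]
  rw [apply_evenDeriv (hf.timeMul hφ), (hasFDerivAt_timeMul hφ hf l).fderiv]
  have h0 : (ContinuousLinearMap.pi fun a =>
      (ContinuousLinearMap.proj (Sum.inr a) : (Fin 1 ⊕ α → ℝ) →L[ℝ] ℝ))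
      (Pi.single (Sum.inl 0) 1) = 0 := by
    funext a; simp
  simp only [add_apply, smul_apply,
    ContinuousLinearMap.comp_apply, h0, map_zero, smul_zero, zero_add, map_smul]
  simp [mul_comm]

lemma pd_fibIdx_timeMul {φ : ℝ → ℝ} {f : SFun α β} {z : Fin 1 ⊕ α → ℝ}
    (hφ : DifferentiableAt ℝ φ (z (Sum.inl 0))) (hf : DiffAt f fun a => z (Sum.inr a))
    (V : α ⊕ β) :
    pd (fibIdx V) (timeMul φ f) z
      = φ (z (Sum.inl 0)) • fibMap (pd V f fun a => z (Sum.inr a)) := by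
  rcases V with a | B
  · refine eq_of_forall_dual fun l => ?_
    simp only [fibIdx, pd]
    rw [apply_evenDeriv (hf.timeMul hφ), (hasFDerivAt_timeMul hφ hf l).fderiv]
    have h0 : (ContinuousLinearMap.pi fun a =>
        (ContinuousLinearMap.proj (Sum.inr a) : (Fin 1 ⊕ α → ℝ) →L[ℝ] ℝ))
        (Pi.single (Sum.inr a) 1) = Pi.single a 1 := by
      funext b; simp [Pi.single_apply]
    have h1 := apply_evenDeriv hf a (l ∘ₗ fibMap.toLinearMap)
    simp only [LinearMap.comp_apply, AlgHom.toLinearMap_apply] at h1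
    simp only [add_apply, smul_apply,
      ContinuousLinearMap.comp_apply, h0, map_smul, h1]
    simp
  · simp only [fibIdx, pd, timeMul, map_smul, contractLeft_fibMap_inr]

end Product

/-! The Levi-Civita connection of the warped product -/

section Warped

variable {α β : Type*} [Fintype α] [DecidableEq α] [Fintype β] [DecidableEq β]

/-- The components of the warped product metric in a product chart. -/
noncomputable def warpedForm (h : ℝ → ℝ) (g : α ⊕ β → α ⊕ β → SFun α β)
    (I J : (Fin 1 ⊕ α) ⊕ (Fin 2 ⊕ β)) : SFun (Fin 1 ⊕ α) (Fin 2 ⊕ β) :=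
  match factor I, factor J with
    | Sum.inl (Sum.inl _), Sum.inl (Sum.inl _) => fun _ => algebraMap ℝ _ (-1)
    | Sum.inl (Sum.inr A), Sum.inl (Sum.inr B) => fun _ => algebraMap ℝ _ (!![0, -1; 1, 0] A B)
    | Sum.inr V, Sum.inr W => timeMul (fun t => h t ^ 2) (g V W)
    | _, _ => fun _ => 0

lemma warped_eq_warpedForm {q n : ℕ} (N : SuperAtlas.{u, v} (Fin q) (Fin n)) (g : N.Form)
    (h : ℝ → ℝ) (i : (R12.prod N).Idx) :
    warped gR12 (ofTime fun t => h t ^ 2) g i = warpedForm h (g i.2) := by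
  funext I J z
  rcases idx_cases I with rfl | ⟨A, rfl⟩ | ⟨V, rfl⟩ <;>
  rcases idx_cases J with rfl | ⟨B, rfl⟩ | ⟨W, rfl⟩ <;>
  simp only [warped, warpedForm, factor_timeIdx, factor_oddIdx, factor_fibIdx, Pi.zero_apply]
  · simp [pr₁, gR12]
  · simp [pr₁, gR12]
  · simp [pr₁, gR12]
  · fin_cases A <;> fin_cases B <;> simp [pr₁, gR12]
  · simp only [Pi.mul_apply, pr₁, ofTime, AlgHom.commutes, timeMul, Algebra.smul_def]
    rfl

/-- The Christoffel symbols of the warped product. -/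
noncomputable def warpedConn (h : ℝ → ℝ) (g : α ⊕ β → α ⊕ β → SFun α β)
    (Γ : α ⊕ β → α ⊕ β → VF α β) (I J : (Fin 1 ⊕ α) ⊕ (Fin 2 ⊕ β)) :
    VF (Fin 1 ⊕ α) (Fin 2 ⊕ β) := fun K =>
  match factor I, factor J, factor K with
    | Sum.inl (Sum.inl _), Sum.inr V, Sum.inr W => timeMul (fun t => deriv h t / h t) (frame V W)
    | Sum.inr V, Sum.inl (Sum.inl _), Sum.inr W => timeMul (fun t => deriv h t / h t) (frame V W)
    | Sum.inr V, Sum.inr W, Sum.inl (Sum.inl _) => timeMul (fun t => h t * deriv h t) (g V W)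
    | Sum.inr V, Sum.inr W, Sum.inr U => timeMul (fun _ => 1) (Γ V W U)
    | _, _, _ => fun _ => 0

variable {h : ℝ → ℝ} {g : α ⊕ β → α ⊕ β → SFun α β} {Γ : α ⊕ β → α ⊕ β → VF α β}
  {z : Fin 1 ⊕ α → ℝ}

lemma timeMul_apply (φ : ℝ → ℝ) (f : SFun α β) :
    timeMul φ f z = φ (z (Sum.inl 0)) • fibMap (f fun a => z (Sum.inr a)) := rfl

lemma diffAt_frame (V W : α ⊕ β) (x : α → ℝ) : DiffAt (frame V W) x := fun l => by
  change DifferentiableAt ℝ (fun _ => l (if W = V then 1 else 0)) x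
  exact differentiableAt_const _

lemma pd_frame (I V W : α ⊕ β) (x : α → ℝ) : pd I (frame V W) x = 0 := by
  by_cases hW : W = V
  · have : frame V W = fun _ => 1 := by funext y; simp [frame, hW]
    rw [this, pd_one]
  · have : frame V W = fun _ => 0 := by funext y; simp [frame, hW]
    rw [this, pd_zero]

lemma hasParity_frame (V W : α ⊕ β) (x : α → ℝ) :
    HasParity (parity V + parity W) (frame V W x) := by
  by_cases hW : W = V
  · simp only [frame, hW, if_true]
    exact HasParity.one (by rw [sgn_add, sgn_mul_self])
  · simp only [frame, hW, if_false]
    exact HasParity.zero _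

lemma HasParity.timeMul {φ : ℝ → ℝ} {f : SFun α β} {p : ℕ}
    (hf : HasParity p (f fun a => z (Sum.inr a))) : HasParity p (timeMul φ f z) :=
  hf.fibMap.smul _

lemma sum_frame_mul (V : α ⊕ β) (x : α → ℝ) (F : α ⊕ β → Grassmann (Fin 2 ⊕ β)) :
    ∑ W, fibMap (frame V W x) * F W = F V := by
  simp [frame, apply_ite]

lemma sum_mul_frame (V : α ⊕ β) (x : α → ℝ) (F : α ⊕ β → Grassmann (Fin 2 ⊕ β)) :
    ∑ W, F W * fibMap (frame W V x) = F V := by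
  simp [frame, apply_ite]

/-- In the metric condition, differentiation along `t` amounts to `(h²)' = 2 h h'`. For a fibre
derivative of a mixed component, `(h'/h) h²` cancels against `h h'` times `⟨∂_t, ∂_t⟩ = -1`. The
purely fibre part is the condition on `N` multiplied by `h²`. -/
lemma leviCivitaAt_warpedConn (hh : ContDiff ℝ ∞ h) (h0 : ∀ t, h t ≠ 0)
    (hΓ : LeviCivitaAt g Γ fun a => z (Sum.inr a))
    (hgd : ∀ V W, DiffAt (g V W) fun a => z (Sum.inr a))
    (hge : ∀ V W, HasParity (parity V + parity W) (g V W fun a => z (Sum.inr a)))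
    (hgs : ∀ V W, (g V W fun a => z (Sum.inr a))
      = sgn (parity V * parity W) • g W V fun a => z (Sum.inr a)) :
    LeviCivitaAt (warpedForm h g) (warpedConn h g Γ) z where
  even I J K := by
    rcases idx_cases I with rfl | ⟨A, rfl⟩ | ⟨V, rfl⟩ <;>
    rcases idx_cases J with rfl | ⟨B, rfl⟩ | ⟨W, rfl⟩ <;>
    rcases idx_cases K with rfl | ⟨C, rfl⟩ | ⟨U, rfl⟩ <;>
    simp only [warpedConn, factor_timeIdx, factor_oddIdx, factor_fibIdx, HasParity.zero,
      parity_timeIdx, parity_fibIdx, zero_add, add_zero]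
    · exact HasParity.timeMul (hasParity_frame _ _ _)
    · exact HasParity.timeMul (hasParity_frame _ _ _)
    · exact HasParity.timeMul (hge _ _)
    · exact HasParity.timeMul (hΓ.even _ _ _)
  torsionFree I J K := by
    rcases idx_cases I with rfl | ⟨A, rfl⟩ | ⟨V, rfl⟩ <;>
    rcases idx_cases J with rfl | ⟨B, rfl⟩ | ⟨W, rfl⟩ <;>
    rcases idx_cases K with rfl | ⟨C, rfl⟩ | ⟨U, rfl⟩ <;>
    simp only [warpedConn, factor_timeIdx, factor_oddIdx, factor_fibIdx, smul_zero,
      parity_timeIdx, parity_fibIdx, zero_mul, mul_zero, sgn_zero, one_smul]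
    · rw [timeMul_apply, timeMul_apply, hgs V W, map_smul, smul_comm]
    · rw [timeMul_apply, timeMul_apply, hΓ.torsionFree V W, map_smul, smul_comm]
  metric I J K := by
    have hd : Differentiable ℝ h := hh.differentiable (by simp)
    have hd2 : DifferentiableAt ℝ (fun t => h t ^ 2) (z (Sum.inl 0)) := (hd _).pow 2
    have e2 : deriv (fun t => h t ^ 2) (z (Sum.inl 0))
        = 2 * (h (z (Sum.inl 0)) * deriv h (z (Sum.inl 0))) := by
      rw [deriv_fun_pow (hd _)]; ring
    have hne := h0 (z (Sum.inl 0))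
    have hwarp : deriv h (z (Sum.inl 0)) / h (z (Sum.inl 0)) * h (z (Sum.inl 0)) ^ 2
        = h (z (Sum.inl 0)) * deriv h (z (Sum.inl 0)) := by field_simp
    simp only [sum_idx]
    rcases idx_cases I with rfl | ⟨A, rfl⟩ | ⟨V, rfl⟩ <;>
    rcases idx_cases J with rfl | ⟨B, rfl⟩ | ⟨W, rfl⟩ <;>
    rcases idx_cases K with rfl | ⟨C, rfl⟩ | ⟨U, rfl⟩ <;>
    simp only [warpedForm, warpedConn, factor_timeIdx, factor_oddIdx, factor_fibIdx,
      parity_timeIdx, parity_fibIdx, zero_mul, mul_zero, sgn_zero, one_smul, smul_zero,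
      Finset.sum_const_zero, add_zero, zero_add, pd_zero, pd_const_real, pd_oddIdx_timeMul]
    · rw [pd_timeIdx_timeMul hd2 (hgd W U), e2]
      simp only [timeMul_apply, smul_mul_assoc, ← Finset.smul_sum, sum_frame_mul]
      rw [hgs U W, map_smul]
      simp only [smul_smul]
      rw [← add_smul]
      congr 1
      rw [mul_comm (parity U)]
      field_simp
      linear_combination (-deriv h (z (Sum.inl 0))) * sgn_mul_self (parity W * parity U)
    · simp only [timeMul_apply, smul_mul_assoc, ← Finset.smul_sum, sum_frame_mul, smul_smul,
        map_neg, map_one, mul_neg, mul_one]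
      rw [hwarp, add_neg_cancel]
    · simp only [timeMul_apply, smul_mul_assoc, ← Finset.smul_sum, sum_frame_mul, smul_smul,
        map_neg, map_one, mul_neg, mul_one]
      rw [hwarp, neg_add_cancel]
    · rw [pd_fibIdx_timeMul hd2 (hgd W U), hΓ.metric]
      simp only [timeMul_apply, one_smul, mul_smul_comm, ← Finset.smul_sum, map_add, map_smul,
        map_sum, map_mul, smul_add]
      rw [smul_comm]

/-- The matrix is block diagonal: the blocks of `ℝ^{(1,2)}` are constant and invertible, and the
fibre block is `h²` times the image of an invertible matrix under a ring homomorphism. -/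
lemma warpedForm_nondegenerate (h0 : ∀ t, h t ≠ 0)
    (hg : IsUnit (Matrix.of fun I J => g I J fun a => z (Sum.inr a) :
      Matrix (α ⊕ β) (α ⊕ β) (Grassmann β)))
    (v : (Fin 1 ⊕ α) ⊕ (Fin 2 ⊕ β) → Grassmann (Fin 2 ⊕ β))
    (hv : ∀ K, ∑ L, v L * warpedForm h g L K z = 0) : v = 0 := by
  simp only [sum_idx] at hv
  have ht : v timeIdx = 0 := by
    have := hv timeIdx
    simpa [warpedForm] using this
  have ho : ∀ A, v (oddIdx A) = 0 := by
    intro A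
    have h1 := hv (oddIdx 0)
    have h2 := hv (oddIdx 1)
    simp [warpedForm] at h1 h2
    fin_cases A
    · exact h2
    · exact h1
  have hf : (fun V => v (fibIdx V)) = 0 := by
    obtain ⟨M, hM⟩ := hg
    have hu : IsUnit ((fibMap : Grassmann β →ₐ[ℝ] Grassmann (Fin 2 ⊕ β)).toRingHom.mapMatrix
      (Matrix.of fun I J => g I J fun a => z (Sum.inr a))) := IsUnit.map _ ⟨M, hM⟩
    obtain ⟨P, hP⟩ := hu
    have h1 : Matrix.vecMul (fun V => v (fibIdx V)) P.val = 0 := by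
      rw [hP]
      funext W
      have := hv (fibIdx W)
      simp only [warpedForm, factor_timeIdx, factor_oddIdx, factor_fibIdx, mul_zero,
        Finset.sum_const_zero, zero_add, timeMul_apply, mul_smul_comm, ← Finset.smul_sum] at this
      exact (smul_eq_zero.mp this).resolve_left (pow_ne_zero 2 (h0 _))
    have h2 := congrArg (fun w => Matrix.vecMul w P⁻¹.val) h1
    simpa [Matrix.vecMul_vecMul] using h2
  funext I
  rcases idx_cases I with rfl | ⟨A, rfl⟩ | ⟨V, rfl⟩
  · exact ht
  · exact ho A
  · exact congrFun hf V

end Warped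

/-! The Ricci tensor of the warped product -/

section WarpedRicci

variable {α β : Type*} [Fintype α] [DecidableEq α] [Fintype β] [DecidableEq β]
  {h : ℝ → ℝ} {g : α ⊕ β → α ⊕ β → SFun α β} {Γ : α ⊕ β → α ⊕ β → VF α β}
  {z : Fin 1 ⊕ α → ℝ}

/-- No Christoffel symbol depends on `ξ, η` or has one of them as a lower index. These directions
are therefore flat, and every curvature or Ricci component with such an argument vanishes. -/
lemma pd_oddIdx_warpedConn (A : Fin 2) (I J K : (Fin 1 ⊕ α) ⊕ (Fin 2 ⊕ β)) :
    pd (oddIdx A) (warpedConn h g Γ I J K) z = 0 := by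
  rcases idx_cases I with rfl | ⟨A, rfl⟩ | ⟨V, rfl⟩ <;>
  rcases idx_cases J with rfl | ⟨B, rfl⟩ | ⟨W, rfl⟩ <;>
  rcases idx_cases K with rfl | ⟨C, rfl⟩ | ⟨U, rfl⟩ <;>
  simp only [warpedConn, factor_timeIdx, factor_oddIdx, factor_fibIdx, pd_zero,
    pd_oddIdx_timeMul]

lemma warpedConn_oddIdx_left (A : Fin 2) (J K : (Fin 1 ⊕ α) ⊕ (Fin 2 ⊕ β)) :
    warpedConn h g Γ (oddIdx A) J K = fun _ => 0 := by
  simp only [warpedConn, factor_oddIdx]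

lemma warpedConn_oddIdx_right (A : Fin 2) (I K : (Fin 1 ⊕ α) ⊕ (Fin 2 ⊕ β)) :
    warpedConn h g Γ I (oddIdx A) K = fun _ => 0 := by
  rcases idx_cases I with rfl | ⟨B, rfl⟩ | ⟨V, rfl⟩ <;>
  simp only [warpedConn, factor_timeIdx, factor_oddIdx, factor_fibIdx]

lemma curvature_oddIdx_left (A : Fin 2) (J K L : (Fin 1 ⊕ α) ⊕ (Fin 2 ⊕ β)) :
    curvature (warpedConn h g Γ) (oddIdx A) J K L z = 0 := by
  simp only [curvature_apply, warpedConn_oddIdx_left, pd_oddIdx_warpedConn, pd_zero, mul_zero,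
    twist_map_zero, zero_mul, Finset.sum_const_zero, add_zero, smul_zero, sub_zero]

lemma curvature_oddIdx_middle (A : Fin 2) (I K L : (Fin 1 ⊕ α) ⊕ (Fin 2 ⊕ β)) :
    curvature (warpedConn h g Γ) I (oddIdx A) K L z = 0 := by
  simp only [curvature_apply, warpedConn_oddIdx_left, pd_oddIdx_warpedConn, pd_zero, mul_zero,
    twist_map_zero, zero_mul, Finset.sum_const_zero, add_zero, smul_zero, sub_zero]

lemma curvature_oddIdx_right (A : Fin 2) (I J L : (Fin 1 ⊕ α) ⊕ (Fin 2 ⊕ β)) :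
    curvature (warpedConn h g Γ) I J (oddIdx A) L z = 0 := by
  simp only [curvature_apply, warpedConn_oddIdx_right, pd_zero,
    twist_map_zero, zero_mul, Finset.sum_const_zero, add_zero, smul_zero, sub_zero]

lemma ricci_oddIdx_left (A : Fin 2) (K : (Fin 1 ⊕ α) ⊕ (Fin 2 ⊕ β)) :
    ricci (warpedConn h g Γ) (oddIdx A) K z = 0 := by
  simp [ricci, curvature_oddIdx_middle, curvature_oddIdx_right]

lemma ricci_oddIdx_right (A : Fin 2) (J : (Fin 1 ⊕ α) ⊕ (Fin 2 ⊕ β)) :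
    ricci (warpedConn h g Γ) J (oddIdx A) z = 0 := by
  simp [ricci, curvature_oddIdx_middle, curvature_oddIdx_right]

/-- This is built into the supersymmetrized definition and holds for every `Γ`. -/
lemma ricci_swap {α β : Type*} [Fintype α] [DecidableEq α] [Fintype β] [DecidableEq β]
    (Γ : α ⊕ β → α ⊕ β → VF α β) (J K : α ⊕ β) (x : α → ℝ) :
    ricci Γ J K x = sgn (parity J * parity K) • ricci Γ K J x := by
  simp only [ricci, Finset.smul_sum]
  refine Finset.sum_congr rfl fun I _ => ?_
  have e : sgn (parity I * (parity I + parity J + parity K))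
      = sgn (parity I * (parity I + parity K + parity J)) := by ring_nf
  rw [e, mul_comm (parity K) (parity J)]
  simp only [smul_add, smul_smul]
  rw [add_comm]
  congr 2
  · ring
  · linear_combination (-(1 / 2) * sgn (parity I * (parity I + parity K + parity J))) *
      sgn_mul_self (parity J * parity K)

variable (hh : ContDiff ℝ ∞ h) (h0 : ∀ t, h t ≠ 0)

include hh in
lemma differentiable_deriv : Differentiable ℝ (deriv h) :=
  ((contDiff_infty_iff_deriv.mp hh).2).differentiable (by simp)

include hh h0 in
lemma differentiable_deriv_div : Differentiable ℝ fun t => deriv h t / h t := fun t =>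
  (differentiable_deriv hh t).div (hh.differentiable (by simp) t) (h0 t)

include hh in
lemma differentiable_mul_deriv : Differentiable ℝ fun t => h t * deriv h t := fun t =>
  (hh.differentiable (by simp) t).mul (differentiable_deriv hh t)

include hh h0 in
lemma deriv_deriv_div (t : ℝ) : deriv (fun t => deriv h t / h t) t
    + deriv h t / h t * (deriv h t / h t) = deriv (deriv h) t / h t := by
  rw [deriv_fun_div (differentiable_deriv hh t) (hh.differentiable (by simp) t) (h0 t)]
  have := h0 t
  field_simp
  ring

include hh in
lemma deriv_mul_deriv (t : ℝ) : deriv (fun t => h t * deriv h t) t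
    = deriv h t ^ 2 + h t * deriv (deriv h) t := by
  rw [deriv_fun_mul (hh.differentiable (by simp) t) (differentiable_deriv hh t)]
  ring

include hh h0 in
-- Each fibre direction contributes `-h''/h`, by the Riccati identity `deriv_deriv_div`, weighted
-- with its supertrace sign.
lemma ricci_timeIdx_timeIdx : ricci (warpedConn h g Γ) timeIdx timeIdx z =
    algebraMap ℝ _ (-(∑ V : α ⊕ β, sgn (parity V)) *
      (deriv (deriv h) (z (Sum.inl 0)) / h (z (Sum.inl 0)))) := by
  have h1 : curvature (warpedConn h g Γ) timeIdx timeIdx timeIdx timeIdx z = 0 := by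
    simp [curvature_apply, sgn_zero]
  have h2 : ∀ V, curvature (warpedConn h g Γ) (fibIdx V) timeIdx timeIdx (fibIdx V) z =
      -((deriv (deriv h) (z (Sum.inl 0)) / h (z (Sum.inl 0))) • (1 : Grassmann (Fin 2 ⊕ β))) := by
    intro V
    simp only [curvature_apply, sum_idx, warpedConn, factor_timeIdx, factor_oddIdx, factor_fibIdx,
      pd_zero, parity_timeIdx, twist_zero, twist_map_zero, zero_mul, mul_zero,
      Finset.sum_const_zero, add_zero, zero_add, sgn_zero, one_smul, zero_sub]
    rw [pd_timeIdx_timeMul (differentiable_deriv_div hh h0 _) (diffAt_frame _ _ _)]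
    simp only [timeMul_apply, smul_mul_assoc, mul_smul_comm, ← Finset.smul_sum, sum_frame_mul,
      smul_smul]
    rw [← add_smul, deriv_deriv_div hh h0]
    simp [frame]
  simp only [ricci, sum_idx, h1, h2, curvature_oddIdx_left, parity_timeIdx, parity_fibIdx,
    mul_zero, sgn_zero, one_smul, smul_zero, add_zero, zero_add, Finset.sum_const_zero, sgn_sq]
  rw [Algebra.algebraMap_eq_smul_one, neg_mul, Finset.sum_mul, neg_smul, Finset.sum_smul,
    ← Finset.sum_neg_distrib]
  refine Finset.sum_congr rfl fun V _ => ?_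
  rw [← two_smul ℝ, smul_smul (1 / 2 : ℝ)]
  norm_num
  rw [smul_smul]

variable (hΓ : LeviCivitaAt g Γ fun a => z (Sum.inr a))
  (hΓd : ∀ U V W, DiffAt (Γ U V W) fun a => z (Sum.inr a))

include hh h0 hΓ hΓd in
-- Both halves of the symmetrized trace vanish. In `R(∂_V, ∂_t)∂_W` the symbols of `N` do not depend
-- on `t` and the quadratic terms agree; in `R(∂_V, ∂_W)∂_t` the two terms cancel because `N` is
-- torsion-free.
lemma ricci_timeIdx_fibIdx (W : α ⊕ β) :
    ricci (warpedConn h g Γ) timeIdx (fibIdx W) z = 0 := by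
  have h1 : curvature (warpedConn h g Γ) timeIdx timeIdx (fibIdx W) timeIdx z = 0 := by
    simp [curvature_apply, sgn_zero]
  have h2 : curvature (warpedConn h g Γ) timeIdx (fibIdx W) timeIdx timeIdx z = 0 := by
    simp only [curvature_apply, sum_idx, warpedConn, factor_timeIdx, factor_oddIdx, factor_fibIdx,
      pd_zero, parity_timeIdx, twist_zero, twist_map_zero, zero_mul, mul_zero,
      Finset.sum_const_zero, add_zero, sgn_zero, one_smul, sub_zero]
  have h3 : ∀ V, curvature (warpedConn h g Γ) (fibIdx V) timeIdx (fibIdx W) (fibIdx V) z = 0 := by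
    intro V
    simp only [curvature_apply, sum_idx, warpedConn, factor_timeIdx, factor_oddIdx, factor_fibIdx,
      parity_timeIdx, twist_zero, twist_map_zero, zero_mul, mul_zero,
      Finset.sum_const_zero, add_zero, zero_add, sgn_zero, one_smul]
    rw [pd_timeIdx_timeMul (differentiableAt_const _) (hΓd _ _ _),
      pd_fibIdx_timeMul (differentiable_deriv_div hh h0 _) (diffAt_frame _ _ _), pd_frame]
    simp only [timeMul_apply, twist_smul, twist_fibMap, twist_frame, smul_mul_assoc,
      mul_smul_comm, ← Finset.smul_sum, sum_frame_mul, sum_mul_frame, deriv_const, zero_smul,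
      map_zero, smul_zero, zero_add, one_smul, sub_self]
  have h4 : ∀ V, curvature (warpedConn h g Γ) (fibIdx V) (fibIdx W) timeIdx (fibIdx V) z = 0 := by
    intro V
    simp only [curvature_apply, sum_idx, warpedConn, factor_timeIdx, factor_oddIdx, factor_fibIdx,
      parity_fibIdx, twist_map_zero, zero_mul, mul_zero,
      Finset.sum_const_zero, add_zero, zero_add]
    rw [pd_fibIdx_timeMul (differentiable_deriv_div hh h0 _) (diffAt_frame _ _ _),
      pd_fibIdx_timeMul (differentiable_deriv_div hh h0 _) (diffAt_frame _ _ _), pd_frame,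
      pd_frame]
    simp only [timeMul_apply, twist_smul, twist_fibMap, twist_frame, smul_mul_assoc,
      ← Finset.smul_sum, sum_frame_mul, map_zero, smul_zero, zero_add, one_smul]
    rw [hΓ.torsionFree V W V, map_smul, smul_comm, sub_self]
  simp only [ricci, sum_idx, h1, h2, h3, h4, curvature_oddIdx_left, smul_zero, add_zero,
    Finset.sum_const_zero]

include hh h0 hΓ hΓd in
lemma ricci_fibIdx_timeIdx (W : α ⊕ β) :
    ricci (warpedConn h g Γ) (fibIdx W) timeIdx z = 0 := by
  rw [ricci_swap, ricci_timeIdx_fibIdx hh h0 hΓ hΓd, smul_zero]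

variable (hgd : ∀ V W, DiffAt (g V W) fun a => z (Sum.inr a))
  (hge : ∀ V W, HasParity (parity V + parity W) (g V W fun a => z (Sum.inr a)))
  (hgs : ∀ V W, (g V W fun a => z (Sum.inr a))
    = sgn (parity V * parity W) • g W V fun a => z (Sum.inr a))

include hh h0 hgd in
-- The derivative `(h h')' = h'² + h h''` loses its `h'²` to the quadratic term `(h'/h)(h h')`.
lemma curvature_timeIdx_fibIdx_fibIdx (V W : α ⊕ β) :
    curvature (warpedConn h g Γ) timeIdx (fibIdx V) (fibIdx W) timeIdx z =
      (h (z (Sum.inl 0)) * deriv (deriv h) (z (Sum.inl 0))) •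
        fibMap (g V W fun a => z (Sum.inr a)) := by
  simp only [curvature_apply, sum_idx, warpedConn, factor_timeIdx, factor_oddIdx, factor_fibIdx,
    pd_zero, parity_timeIdx, twist_zero, twist_map_zero, zero_mul, mul_zero,
    Finset.sum_const_zero, add_zero, zero_add, sgn_zero, one_smul]
  rw [pd_timeIdx_timeMul (differentiable_mul_deriv hh _) (hgd _ _), deriv_mul_deriv hh]
  simp only [timeMul_apply, twist_smul, twist_fibMap, twist_frame, smul_mul_assoc,
    mul_smul_comm, ← Finset.smul_sum, sum_frame_mul, smul_smul]
  rw [← sub_smul]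
  congr 1
  have := h0 (z (Sum.inl 0))
  field_simp
  ring

include hh h0 hΓd hge in
-- A Gauss equation: the correction to the curvature of `N` consists of the quadratic terms with
-- intermediate index `t`, each with coefficient `h h' · h'/h = h'²`.
lemma curvature_fibIdx_fibIdx_fibIdx (U V W : α ⊕ β) :
    curvature (warpedConn h g Γ) (fibIdx U) (fibIdx V) (fibIdx W) (fibIdx U) z =
      fibMap (curvature Γ U V W U fun a => z (Sum.inr a)) +
      deriv h (z (Sum.inl 0)) ^ 2 • (sgn (parity U * (parity V + parity W)) •
          fibMap (g V W fun a => z (Sum.inr a)) -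
        if V = U then sgn (parity V * parity W) • fibMap (g V W fun a => z (Sum.inr a))
        else 0) := by
  simp only [curvature_apply, sum_idx, warpedConn, factor_timeIdx, factor_oddIdx, factor_fibIdx,
    parity_fibIdx, twist_map_zero, mul_zero, Finset.sum_const_zero, add_zero]
  rw [pd_fibIdx_timeMul (differentiableAt_const _) (hΓd _ _ _),
    pd_fibIdx_timeMul (differentiableAt_const _) (hΓd _ _ _)]
  simp only [timeMul_apply, twist_smul, twist_fibMap, (hge _ _).twist, smul_mul_assoc,
    mul_smul_comm, one_smul, map_sub, map_add, map_smul, map_sum, map_mul]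
  have e : h (z (Sum.inl 0)) * deriv h (z (Sum.inl 0)) *
      (deriv h (z (Sum.inl 0)) / h (z (Sum.inl 0))) = deriv h (z (Sum.inl 0)) ^ 2 := by
    have := h0 (z (Sum.inl 0))
    field_simp
  have f1 : fibMap (frame U U fun a => z (Sum.inr a)) = (1 : Grassmann (Fin 2 ⊕ β)) := by
    simp [frame]
  rw [f1, mul_one]
  by_cases hVU : V = U
  · subst hVU
    rw [f1, mul_one, if_pos rfl, ← e]
    simp only [sgn_mul_add]
    have := sgn_mul_self (parity V * parity V)
    match_scalars
    · ring
    · linear_combination (-(h (z (Sum.inl 0)) * deriv h (z (Sum.inl 0)) *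
        (deriv h (z (Sum.inl 0)) / h (z (Sum.inl 0)))) * sgn (parity V * parity W)) * this
    · ring
  · have f2 : fibMap (frame V U fun a => z (Sum.inr a)) = (0 : Grassmann (Fin 2 ⊕ β)) := by
      simp [frame, Ne.symm hVU]
    rw [f2, mul_zero, if_neg hVU, ← e]
    module

include hh h0 hΓd hgd hge hgs in
lemma ricci_fibIdx_fibIdx (V W : α ⊕ β) :
    ricci (warpedConn h g Γ) (fibIdx V) (fibIdx W) z =
      fibMap (ricci Γ V W fun a => z (Sum.inr a)) +
      (h (z (Sum.inl 0)) * deriv (deriv h) (z (Sum.inl 0)) +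
        (∑ U : α ⊕ β, sgn (parity U) - 1) * deriv h (z (Sum.inl 0)) ^ 2) •
          fibMap (g V W fun a => z (Sum.inr a)) := by
  set G := fibMap (g V W fun a => z (Sum.inr a)) with hG
  have hG' : fibMap (g W V fun a => z (Sum.inr a)) = sgn (parity V * parity W) • G := by
    rw [hgs W V, map_smul, mul_comm]
  have hS := sgn_mul_self (parity V * parity W)
  -- The supertrace sign reduces the first Gauss term to `(-1)^{|U|}`, which sums to the
  -- superdimension. The second survives only for `U = V` in one half of the symmetrization and `U =
  -- W` in the other, so it removes `1/2 + 1/2 = 1` in total.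
  have hU : ∀ U, sgn (parity U * (parity U + parity V + parity W)) • (1 / 2 : ℝ) •
      (curvature (warpedConn h g Γ) (fibIdx U) (fibIdx V) (fibIdx W) (fibIdx U) z +
        sgn (parity V * parity W) •
          curvature (warpedConn h g Γ) (fibIdx U) (fibIdx W) (fibIdx V) (fibIdx U) z) =
      fibMap (sgn (parity U * (parity U + parity V + parity W)) • (1 / 2 : ℝ) •
        (curvature Γ U V W U (fun a => z (Sum.inr a)) + sgn (parity V * parity W) •
          curvature Γ U W V U fun a => z (Sum.inr a))) +
      ((sgn (parity U) - ((if V = U then 1 / 2 else 0) + if W = U then 1 / 2 else 0)) *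
        deriv h (z (Sum.inl 0)) ^ 2) • G := by
    intro U
    have hUV := sgn_mul_self (parity U * parity V)
    have hUW := sgn_mul_self (parity U * parity W)
    have hUU := sgn_sq (parity U)
    rw [curvature_fibIdx_fibIdx_fibIdx hh h0 hΓd hge, curvature_fibIdx_fibIdx_fibIdx hh h0 hΓd hge,
      hG', mul_comm (parity W) (parity V), ← hG]
    simp only [sgn_mul_add, map_smul, map_add]
    rw [sgn_sq]
    have hu := sgn_mul_self (parity U)
    by_cases hVU : V = U <;> by_cases hWU : W = U
    · subst hVU
      subst hWU
      simp only [if_true, sgn_sq] at *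
      match_scalars <;> grind
    · subst hVU
      simp only [if_true, if_neg hWU, sgn_sq] at *
      match_scalars <;> grind
    · subst hWU
      simp only [if_true, if_neg hVU, sgn_sq, mul_comm (parity W) (parity V)] at *
      match_scalars <;> grind
    · simp only [if_neg hVU, if_neg hWU] at *
      match_scalars <;> grind
  simp only [ricci, sum_idx, curvature_oddIdx_left, parity_timeIdx, parity_fibIdx, hU,
    curvature_timeIdx_fibIdx_fibIdx hh h0 hgd, hG', smul_zero, add_zero, Finset.sum_const_zero,
    Finset.sum_add_distrib, ← map_sum, zero_mul, sgn_zero, one_smul, ← hG]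
  rw [← Finset.sum_smul, ← Finset.sum_mul, Finset.sum_sub_distrib, Finset.sum_add_distrib,
    Finset.sum_ite_eq, Finset.sum_ite_eq]
  simp only [Finset.mem_univ, if_true]
  match_scalars
  · linear_combination (h (z (Sum.inl 0)) * deriv (deriv h) (z (Sum.inl 0)) / 2) * hS
  · simp

end WarpedRicci

/-! Einstein warped products -/

lemma sum_sgn_parity (q n : ℕ) : ∑ V : Fin q ⊕ Fin n, sgn (parity V) = (q : ℝ) - n := by
  simp [Fintype.sum_sum_type, parity, sgn, sub_eq_add_neg]

section Einstein

variable {q n : ℕ} {N : SuperAtlas.{u, v} (Fin q) (Fin n)} {g₂ : N.Form} {h : ℝ → ℝ}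
  {ΓN : N.Conn} {Γμ : (R12.prod N).Conn}

lemma mem_target_prod (i : (R12.prod N).Idx) (z : Fin 1 ⊕ Fin q → ℝ) :
    z ∈ ((R12.prod N).chart i).target ↔ (fun a => z (Sum.inr a)) ∈ (N.chart i.2).target := by
  constructor
  · exact fun hz => hz.2
  · exact fun hz => ⟨trivial, hz⟩

/-- Uniqueness identifies the given connection with the explicit one at every point of a product
chart; as chart targets are open, the Ricci tensors agree too. -/
lemma christoffel_warped (hg₂ : IsMetric N g₂) (hh : ContDiff ℝ ∞ h) (h0 : ∀ t, h t ≠ 0)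
    (hΓN : IsLeviCivita N g₂ ΓN)
    (hΓμ : IsLeviCivita (R12.prod N) (warped gR12 (ofTime fun t => h t ^ 2) g₂) Γμ)
    (i : (R12.prod N).Idx) {z : Fin 1 ⊕ Fin q → ℝ}
    (hz : (fun a => z (Sum.inr a)) ∈ (N.chart i.2).target)
    (I J K : (Fin 1 ⊕ Fin q) ⊕ (Fin 2 ⊕ Fin n)) :
    Γμ i I J K z = warpedConn h (g₂ i.2) (ΓN i.2) I J K z := by
  have hsymm : ∀ I J, warped gR12 (ofTime fun t => h t ^ 2) g₂ i I J z =
      sgn (parity I * parity J) • warped gR12 (ofTime fun t => h t ^ 2) g₂ i J I z := by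
    intro I J
    rw [warped_eq_warpedForm]
    rcases idx_cases I with rfl | ⟨A, rfl⟩ | ⟨V, rfl⟩ <;>
    rcases idx_cases J with rfl | ⟨B, rfl⟩ | ⟨W, rfl⟩ <;>
    simp only [warpedForm, factor_timeIdx, factor_oddIdx, factor_fibIdx, smul_zero,
      parity_timeIdx, parity_oddIdx, parity_fibIdx, mul_zero, sgn_zero, one_smul]
    · fin_cases A <;> fin_cases B <;> simp [sgn]
    · rw [timeMul_apply, timeMul_apply, hg₂.symm i.2 V W _ hz, map_smul, smul_comm]
  have h1 := hΓμ.leviCivitaAt i ((mem_target_prod i z).mpr hz) hsymm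
  rw [warped_eq_warpedForm] at h1
  exact h1.unique (leviCivitaAt_warpedConn hh h0
      (hΓN.leviCivitaAt i.2 hz fun I J => hg₂.symm i.2 I J _ hz)
      (fun V W => (hg₂.smooth i.2 V W).diffAt (N.chart i.2).open_target hz)
      (fun V W => hg₂.even i.2 V W _ hz) (fun V W => hg₂.symm i.2 V W _ hz))
    (warpedForm_nondegenerate h0 (hg₂.nondegenerate i.2 _ hz)) I J K

lemma ricci_warped (hg₂ : IsMetric N g₂) (hh : ContDiff ℝ ∞ h) (h0 : ∀ t, h t ≠ 0)
    (hΓN : IsLeviCivita N g₂ ΓN)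
    (hΓμ : IsLeviCivita (R12.prod N) (warped gR12 (ofTime fun t => h t ^ 2) g₂) Γμ)
    (i : (R12.prod N).Idx) {z : Fin 1 ⊕ Fin q → ℝ}
    (hz : (fun a => z (Sum.inr a)) ∈ (N.chart i.2).target)
    (J K : (Fin 1 ⊕ Fin q) ⊕ (Fin 2 ⊕ Fin n)) :
    ricci (Γμ i) J K z = ricci (warpedConn h (g₂ i.2) (ΓN i.2)) J K z := by
  refine ricci_congr ?_ J K
  have ho := ((R12.prod N).chart i).open_target.mem_nhds ((mem_target_prod i z).mpr hz)
  filter_upwards [ho] with y hy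
  exact christoffel_warped hg₂ hh h0 hΓN hΓμ i ((mem_target_prod i y).mp hy)

/-- A nonzero metric component allows the coefficient of `g₂` in the fibre equation to be compared
at different times. Without fibre coordinates that equation would be void. -/
lemma exists_metric_ne_zero (hqn : 0 < q + n) (hg₂ : IsMetric N g₂) (i : N.Idx)
    {x : Fin q → ℝ} (hx : x ∈ (N.chart i).target) : ∃ V W, g₂ i V W x ≠ 0 := by
  by_contra! hcon
  have h1 := hg₂.nondegenerate i x hx
  have : Nonempty (Fin q ⊕ Fin n) := by
    rw [← Fintype.card_pos_iff]
    simpa using hqn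
  have h2 : (Matrix.of fun I J => g₂ i I J x :
      Matrix (Fin q ⊕ Fin n) (Fin q ⊕ Fin n) (Grassmann (Fin n))) = 0 := by
    ext I J
    exact hcon I J
  rw [h2] at h1
  exact not_isUnit_zero h1

/-- The warped product is Einstein if and only if the Einstein constant is zero, the superdimension
of the fibre or `h''` vanishes, and the fibre is Einstein with the opposite of the constant value of
`h h'' + (q - n - 1) (h')²` as its Einstein constant. -/
lemma isEinstein_warped_iff (hqn : 0 < q + n) (hN : N.IsSupermanifold) (hne : Nonempty N.Pt)
    (hg₂ : IsMetric N g₂) (hh : ContDiff ℝ ∞ h) (h0 : ∀ t, h t ≠ 0)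
    (hΓN : IsLeviCivita N g₂ ΓN)
    (hΓμ : IsLeviCivita (R12.prod N) (warped gR12 (ofTime fun t => h t ^ 2) g₂) Γμ) (lam : ℝ) :
    IsEinstein (R12.prod N) (warped gR12 (ofTime fun t => h t ^ 2) g₂) Γμ lam ↔
      lam = 0 ∧ (∀ t, ((q : ℝ) - n) * deriv (deriv h) t = 0) ∧
        ∃ c₀, (∀ t, h t * deriv (deriv h) t + ((q : ℝ) - n - 1) * deriv h t ^ 2 = c₀) ∧
          IsEinstein N g₂ ΓN (-c₀) := by
  have hfib : ∀ (i : (R12.prod N).Idx) (V W : Fin q ⊕ Fin n) (z : Fin 1 ⊕ Fin q → ℝ),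
      (fun a => z (Sum.inr a)) ∈ (N.chart i.2).target →
      ricci (Γμ i) (fibIdx V) (fibIdx W) z =
        fibMap (ricci (ΓN i.2) V W (fun a => z (Sum.inr a)) +
          (h (z (Sum.inl 0)) * deriv (deriv h) (z (Sum.inl 0)) +
            ((q : ℝ) - n - 1) * deriv h (z (Sum.inl 0)) ^ 2) •
              g₂ i.2 V W fun a => z (Sum.inr a)) := by
    intro i V W z hz
    rw [ricci_warped hg₂ hh h0 hΓN hΓμ i hz, ricci_fibIdx_fibIdx hh h0
      (fun U V W => (hΓN.smooth i.2 U V W).diffAt (N.chart i.2).open_target hz)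
      (fun V W => (hg₂.smooth i.2 V W).diffAt (N.chart i.2).open_target hz)
      (fun V W => hg₂.even i.2 V W _ hz) (fun V W => hg₂.symm i.2 V W _ hz), sum_sgn_parity,
      map_add, map_smul]
  constructor
  · intro hE
    obtain ⟨p⟩ := hne
    obtain ⟨i₀, hp⟩ := hN.cover p
    have hx₀ := (N.chart i₀).map_source hp
    set x₀ := N.chart i₀ p
    have hE' : ∀ (i : N.Idx) (t : ℝ) (x : Fin q → ℝ), x ∈ (N.chart i).target → ∀ J K,
        ricci (Γμ ((), i)) J K (Sum.elim (fun _ => t) x) =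
          lam • warpedForm h (g₂ i) J K (Sum.elim (fun _ => t) x) := by
      intro i t x hx J K
      have h1 : ∀ j : (R12.prod N).Idx, ∀ z ∈ ((R12.prod N).chart j).target,
          ricci (Γμ j) J K z = lam • warpedForm h (g₂ j.2) J K z := by
        intro j z hz
        rw [← warped_eq_warpedForm]
        exact hE j J K z hz
      exact h1 ((), i) _ ((mem_target_prod ((), i) _).mpr hx)
    -- The component at `(ξ, η)` reads `0 = lam * (-1)`.
    have hlam : lam = 0 := by
      have h1 := hE' i₀ 0 x₀ hx₀ (oddIdx 0) (oddIdx 1)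
      rw [ricci_warped hg₂ hh h0 hΓN hΓμ ((), i₀) hx₀, ricci_oddIdx_left] at h1
      simp only [warpedForm, factor_oddIdx] at h1
      simpa using h1
    subst hlam
    simp only [zero_smul] at hE'
    have hfib' : ∀ (i : N.Idx) (t : ℝ) (x : Fin q → ℝ), x ∈ (N.chart i).target → ∀ V W,
        ricci (ΓN i) V W x + (h t * deriv (deriv h) t +
          ((q : ℝ) - n - 1) * deriv h t ^ 2) • g₂ i V W x = 0 := by
      intro i t x hx V W
      have h1 := hE' i t x hx (fibIdx V) (fibIdx W)
      rw [hfib ((), i) V W _ hx] at h1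
      exact (map_eq_zero_iff _ fibMap_injective).mp h1
    refine ⟨rfl, fun t => ?_, h 0 * deriv (deriv h) 0 + ((q : ℝ) - n - 1) * deriv h 0 ^ 2,
      fun t => ?_, fun i V W x hx => ?_⟩
    · have h1 := hE' i₀ t x₀ hx₀ timeIdx timeIdx
      rw [ricci_warped hg₂ hh h0 hΓN hΓμ ((), i₀) hx₀, ricci_timeIdx_timeIdx hh h0,
        ExteriorAlgebra.algebraMap_eq_zero_iff, sum_sgn_parity] at h1
      simp only [Sum.elim_inl] at h1
      have := h0 t
      field_simp at h1
      linarith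
    -- At a fixed point of `N`, the times `t` and `0` share the same `Ric_N`, so the coefficients of
    -- the nonzero `g₂ V W` coincide.
    · obtain ⟨V, W, hVW⟩ := exists_metric_ne_zero hqn hg₂ i₀ hx₀
      have h1 := (hfib' i₀ t x₀ hx₀ V W).trans (hfib' i₀ 0 x₀ hx₀ V W).symm
      exact smul_left_injective ℝ hVW (add_left_cancel h1)
    · rw [neg_smul]
      exact eq_neg_of_add_eq_zero_left (hfib' i 0 x hx V W)
  · rintro ⟨rfl, hd, c₀, hc, hE⟩ i J K z hz
    have hz' := (mem_target_prod i z).mp hz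
    have hΓ := hΓN.leviCivitaAt i.2 hz' fun I J => hg₂.symm i.2 I J _ hz'
    have hΓd := fun U V W => (hΓN.smooth i.2 U V W).diffAt (N.chart i.2).open_target hz'
    rw [zero_smul]
    rcases idx_cases J with rfl | ⟨A, rfl⟩ | ⟨V, rfl⟩
    · rw [ricci_warped hg₂ hh h0 hΓN hΓμ i hz']
      rcases idx_cases K with rfl | ⟨B, rfl⟩ | ⟨W, rfl⟩
      · rw [ricci_timeIdx_timeIdx hh h0, sum_sgn_parity, ← mul_div_assoc, neg_mul, hd]
        simp
      · rw [ricci_oddIdx_right]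
      · rw [ricci_timeIdx_fibIdx hh h0 hΓ hΓd]
    · rw [ricci_warped hg₂ hh h0 hΓN hΓμ i hz', ricci_oddIdx_left]
    · rcases idx_cases K with rfl | ⟨B, rfl⟩ | ⟨W, rfl⟩
      · rw [ricci_warped hg₂ hh h0 hΓN hΓμ i hz', ricci_fibIdx_timeIdx hh h0 hΓ hΓd]
      · rw [ricci_warped hg₂ hh h0 hΓN hΓμ i hz', ricci_oddIdx_right]
      · rw [hfib i V W z hz', hE i.2 V W _ hz', hc, ← add_smul, neg_add_cancel, zero_smul,
          map_zero]

end Einstein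

/-! ### Affine warping functions -/

lemma eq_linear_of_deriv_deriv_eq_zero {h : ℝ → ℝ} (hh : ContDiff ℝ ∞ h)
    (h2 : ∀ t, deriv (deriv h) t = 0) :
    (∀ t, deriv h t = deriv h 0) ∧ ∀ t, h t = deriv h 0 * t + h 0 := by
  have h1 : ∀ t, deriv h t = deriv h 0 := fun t =>
    is_const_of_deriv_eq_zero (differentiable_deriv hh) h2 t 0
  refine ⟨h1, fun t => ?_⟩
  have hd : Differentiable ℝ h := hh.differentiable (by simp)
  have h3 := is_const_of_deriv_eq_zero (f := fun t => h t - deriv h 0 * t)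
    (hd.sub (differentiable_id.const_mul _)) (fun s => by
      have := ((hd s).hasDerivAt.sub ((hasDerivAt_id s).const_mul (deriv h 0))).deriv
      simp only [id, mul_one, h1 s, sub_self] at this
      exact this) t 0
  simp only [mul_zero, sub_zero] at h3
  linarith

lemma deriv_of_eq_linear {h : ℝ → ℝ} {a b : ℝ} (hl : ∀ t, h t = a * t + b) :
    (∀ t, deriv h t = a) ∧ ∀ t, deriv (deriv h) t = 0 := by
  have h1 : deriv h = fun _ => a := by
    funext t
    rw [show h = fun t => a * t + b from funext hl]
    simp
  exact ⟨fun t => by rw [h1], fun t => by rw [h1, deriv_const]⟩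

end SuperGeometry

theorem theorem4p6 (q n : ℕ) (hqn : 0 < q + n)
    (N : SuperAtlas.{u, v} (Fin q) (Fin n)) (hN : N.IsSupermanifold) (hne : Nonempty N.Pt)
    (g₂ : N.Form) (hg₂ : IsMetric N g₂)
    (h : ℝ → ℝ) (hh : ContDiff ℝ ∞ h) (h0 : ∀ t, h t ≠ 0)
    (ΓN : N.Conn) (hΓN : IsLeviCivita N g₂ ΓN)
    (Γμ : (R12.prod N).Conn)
    (hΓμ : IsLeviCivita (R12.prod N) (warped gR12 (ofTime fun t => h t ^ 2) g₂) Γμ)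
    (lam : ℝ) :
    IsEinstein (R12.prod N) (warped gR12 (ofTime fun t => h t ^ 2) g₂) Γμ lam ↔
      lam = 0 ∧
        ((q = n ∧ ∃ c₀ : ℝ, IsEinstein N g₂ ΓN (-c₀) ∧
            ∀ t, h t * deriv (deriv h) t - deriv h t ^ 2 = c₀) ∨
          ((q : ℤ) - n = 1 ∧ IsEinstein N g₂ ΓN 0 ∧
            ∃ c₁ c₂ : ℝ, ∀ t, h t = c₁ * t + c₂) ∨
          ((q : ℤ) - n - 1 ≠ 0 ∧ (q : ℤ) - n - 1 ≠ -1 ∧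
            ∃ c₀ c₂ : ℝ, IsEinstein N g₂ ΓN (-c₀) ∧ 0 ≤ c₀ / ((q : ℝ) - n - 1) ∧
              ((∀ t, h t = Real.sqrt (c₀ / ((q : ℝ) - n - 1)) * t + c₂) ∨
                (∀ t, h t = -Real.sqrt (c₀ / ((q : ℝ) - n - 1)) * t + c₂)))) := by

  rw [isEinstein_warped_iff hqn hN hne hg₂ hh h0 hΓN hΓμ]
  refine and_congr_right fun _ => ?_
  -- The cases are distinguished by integers, whereas the superdimension enters the Ricci tensor as
  -- a real number.
  have hcast : ∀ m : ℤ, (q : ℤ) - n = m ↔ (q : ℝ) - n = m := fun m => by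
    rw [← @Int.cast_inj ℝ]
    push_cast
    rfl
  constructor
  · rintro ⟨hd, c₀, hc, hE⟩
    by_cases hq0 : (q : ℤ) - n = 0
    · refine Or.inl ⟨by omega, c₀, hE, fun t => ?_⟩
      have e : (q : ℝ) - n = 0 := by simpa using (hcast 0).mp hq0
      have := hc t
      rw [e] at this
      linarith
    have hq0' : (q : ℝ) - n ≠ 0 := fun e => hq0 ((hcast 0).mpr (by simpa using e))
    have h2 : ∀ t, deriv (deriv h) t = 0 := fun t => (mul_eq_zero.mp (hd t)).resolve_left hq0'
    obtain ⟨h1, hl⟩ := eq_linear_of_deriv_deriv_eq_zero hh h2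
    right
    by_cases hq1 : (q : ℤ) - n = 1
    · have e : (q : ℝ) - n = 1 := by simpa using (hcast 1).mp hq1
      have hc0 : c₀ = 0 := by
        rw [← hc 0, h2, e]
        ring
      refine Or.inl ⟨hq1, by rwa [hc0, neg_zero] at hE, _, _, hl⟩
    · have hne1 : (q : ℝ) - n - 1 ≠ 0 := fun e =>
        hq1 ((hcast 1).mpr (by push_cast; linarith))
      -- The quotient is the square of the slope of `h`; the sign of the slope decides between the
      -- two alternatives.
      have hc0 : c₀ / ((q : ℝ) - n - 1) = deriv h 0 ^ 2 := by
        rw [← hc 0, h2, mul_zero, zero_add, mul_div_cancel_left₀ _ hne1]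
      refine Or.inr ⟨by omega, by omega, c₀, h 0, hE, by rw [hc0]; positivity, ?_⟩
      rw [hc0, Real.sqrt_sq_eq_abs]
      rcases abs_choice (deriv h 0) with e | e
      · left; rw [e]; exact hl
      · right; rw [e, neg_neg]; exact hl
  · rintro (⟨hq, c₀, hE, hc⟩ | ⟨hq, hE, c₁, c₂, hl⟩ | ⟨hq1, hq0, c₀, c₂, hE, hnn, hl⟩)
    · subst hq
      exact ⟨fun t => by simp, c₀, fun t => by rw [← hc t]; ring, hE⟩
    · obtain ⟨h1, h2⟩ := deriv_of_eq_linear hl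
      have e : (q : ℝ) - n = 1 := by simpa using (hcast 1).mp hq
      exact ⟨fun t => by rw [h2, mul_zero], 0, fun t => by rw [h2, e]; ring, by rwa [neg_zero]⟩
    · have hne1 : (q : ℝ) - n - 1 ≠ 0 := fun e =>
        hq1 (by have := (hcast 1).mpr (by push_cast; linarith); omega)
      -- Only the square of the slope enters the equations, so both signs of the root are treated
      -- together.
      obtain ⟨a, ha, hla⟩ : ∃ a, a ^ 2 = c₀ / ((q : ℝ) - n - 1) ∧ ∀ t, h t = a * t + c₂ := by
        rcases hl with hl | hl
        · exact ⟨_, Real.sq_sqrt hnn, hl⟩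
        · exact ⟨_, by rw [neg_sq, Real.sq_sqrt hnn], hl⟩
      obtain ⟨h1, h2⟩ := deriv_of_eq_linear hla
      exact ⟨fun t => by rw [h2, mul_zero], c₀,
        fun t => by rw [h2, h1, ha, mul_zero, zero_add, mul_div_cancel₀ _ hne1], hE⟩
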